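/- **Setting.** A learner and an optimizer repeatedly compete in a single-item auction, either first-price or second-price. In each round the pair of values $(v_L,v_O)\in[0,1]^2$ is drawn independently from a fixed distribution $\mathcal D$. When the learner's pacing multiplier is $\lambda\ge 0$ she bids $\lambda v_L$, and the optimizer's bid is written as $\lambda b$ with $b\ge 0$. The optimizer wins iff $b>v_L$. Her value in the round is $U_O(b,v_L,v_O)=v_O\mathbf 1\{b>v_L\}$, and the payments of the optimizer and the learner are $\lambda P_O$ and $\lambda P_L$, where $$P_O=b\,\mathbf 1\{b>v_L\},\quad P_L=v_L\mathbf 1\{b\le v_L\}\quad\text{(first-price)},\qquad P_O=v_L\mathbf 1\{b>v_L\},\quad P_L=b\,\mathbf 1\{b\le v_L\}\quad\text{(second-price)}.$$ Let $\rho_L,\rho_O>0$ be the per-round budgets of the learner and the optimizer. **BSE value.** For a random bidding function $\hat V:[0,1]\to\mathbb R_{\ge0}$ (the normalized bid is $b=\hat V(v_O)$), let $U_O(\hat V),P_O(\hat V),P_L(\hat V)$ be the expectations of the quantities above. The optimizer's budgeted Stackelberg equilibrium (BSE) value $\mathtt{OPT}$ is the supremum of $\sum_i w_iU_O(\hat V_i)$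 over all finite families of phases $(w_i,\lambda_i,\hat V_i)_i$ with $w_i\ge0$, $\sum_iw_i=1$, $\lambda_i\ge 0$, such that $\lambda_iP_L(\hat V_i)\ge\rho_L$ for every $i$ and $\sum_iw_i\lambda_iP_O(\hat V_i)\le\rho_O$ (with every $P_O(\hat V_i)$ finite). **Repeated game.** The learner starts at some $\lambda^{(1)}\ge0$ and updates $\lambda^{(t+1)}=\lambda^{(t)}+\eta\,(\rho_L-\lambda^{(t)}P_L^{(t)})$ with a step size $\eta\in(0,1)$, where $P_L^{(t)}$ is the value of $P_L$ realized in round $t$. In round $t$ the optimizer chooses a bidding function $\hat v^{(t)}:[0,1]\to\mathbb R_{\ge0}$ (possibly randomized) that depends only on the values of the previous rounds, and bids $\lambda^{(t)}\hat v^{(t)}(v_O^{(t)})$. A $T$-round strategy is budgeted if $\sum_{t\le T}\lambda^{(t)}P_O^{(t)}\le\rho_OT$ almost surely; let $V$ be the expected total value $\mathbb E\sum_{t\le T}U_O^{(t)}$ that it obtains. **Theorem.** Assume that $\mathbb E[v_L]>0$ and that there is $\varepsilon>0$ with $\Pr[0<v_L<\varepsilon v_O]=0$. Then, in both first- and second-price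 auctions: 1. There is a constant $C>0$, depending only on the auction format, $\mathcal D$, $\rho_O$ and $\rho_L$, such that for all $\eta\in(0,1)$, $\sigma>0$, $T\ge 0$, $\lambda^{(1)}\ge0$ and every budgeted strategy, $$V\le T\cdot\mathtt{OPT}+C\Big(\sigma T+\frac{\eta T}{\sigma}+\frac1\eta\Big).$$ 2. For $\eta=\Theta(T^{-2/3})$ the excess is $O(T^{2/3})$: for all $c_1>0$ and $c_2$ there is $C>0$, depending only on these and on the data in 1, such that $V\le T\cdot\mathtt{OPT}+C\,T^{2/3}$ for all $T\ge1$, all $\eta\in(0,1)$ with $c_1T^{-2/3}\le\eta\le c_2T^{-2/3}$, all $\lambda^{(1)}\ge0$ and every budgeted strategy. 3. The optimizer gets at most $T\cdot\mathtt{OPT}+o(T)$: if the step sizes $\eta_T\in(0,1)$ satisfy $\eta_T\to0$ and $T\eta_T\to\infty$, then there is a sequence $r(T)=o(T)$ with $V\le T\cdot\mathtt{OPT}+r(T)$ for all $T$, all $\lambda^{(1)}\ge0$ and every budgeted strategy against step size $\eta_T$. -/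

import Mathlib

open MeasureTheory ProbabilityTheory Filter Topology Asymptotics
open scoped NNReal

noncomputable section

/-- The two single-item auction formats. -/
inductive AuctionFormat : Type where
  | firstPrice : AuctionFormat
  | secondPrice : AuctionFormat

/-- A pair `(v_L, v_O)` of values in `[0, 1]`: first the learner's, then the optimizer's. -/
abbrev ValuePair : Type := unitInterval × unitInterval

/-! When the learner's multiplier is `lam`, she bids `lam * v_L`, and the optimizer's bid is written
as `lam * b`; `b` is her normalized bid. The optimizer wins iff `v_L < b` (ties go to the learner),
and all payments are `lam` times the normalized payments `payO`, `payL` below. -/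

/-- `U_O(b, v_L, v_O)`: the value the optimizer obtains in one round with normalized bid `b`. -/
def valO (b : ℝ≥0) (v : ValuePair) : ℝ :=
  if (v.1 : ℝ) < (b : ℝ) then (v.2 : ℝ) else 0

/-- `P_O(b, v_L, v_O)`: the optimizer's normalized payment. -/
def payO (a : AuctionFormat) (b : ℝ≥0) (v : ValuePair) : ℝ :=
  if (v.1 : ℝ) < (b : ℝ) then
    match a with
    | .firstPrice => (b : ℝ)
    | .secondPrice => (v.1 : ℝ)
  else 0

/-- `P_L(b, v_L, v_O)`: the learner's normalized payment. -/
def payL (a : AuctionFormat) (b : ℝ≥0) (v : ValuePair) : ℝ :=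
  if (v.1 : ℝ) < (b : ℝ) then 0
  else
    match a with
    | .firstPrice => (v.1 : ℝ)
    | .secondPrice => (b : ℝ)

/-! ### The one-shot problem and the Budgeted Stackelberg Equilibrium (BSE) -/

/-- Joint law of `((v_L, v_O), b)` when `(v_L, v_O) ~ D` and, given the values, the normalized bid
`b` is drawn from `κ v_O`. A Markov kernel `κ` plays the role of a random bidding function
`[0, 1] → ℝ≥0`: the optimizer's bid may depend on `v_O` and on private randomness only. -/
def roundLaw (D : Measure ValuePair) (κ : Kernel unitInterval ℝ≥0) : Measure (ValuePair × ℝ≥0) :=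
  D ⊗ₘ (κ.comap Prod.snd measurable_snd)

/-- `U_O(κ)`, the expected value of the optimizer. -/
def expValO (D : Measure ValuePair) (κ : Kernel unitInterval ℝ≥0) : ℝ :=
  ∫ x, valO x.2 x.1 ∂(roundLaw D κ)

/-- `P_O(κ)`, the expected normalized payment of the optimizer. -/
def expPayO (a : AuctionFormat) (D : Measure ValuePair) (κ : Kernel unitInterval ℝ≥0) : ℝ :=
  ∫ x, payO a x.2 x.1 ∂(roundLaw D κ)

/-- `P_L(κ)`, the expected normalized payment of the learner. -/
def expPayL (a : AuctionFormat) (D : Measure ValuePair) (κ : Kernel unitInterval ℝ≥0) : ℝ :=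
  ∫ x, payL a x.2 x.1 ∂(roundLaw D κ)

/-- The values of the feasible points of the BSE program. The optimizer commits to finitely many
phases `i`, of relative lengths `w i`, each with a random bidding function `κ i`. In each phase
the learner's multiplier is `lam i`, at which she spends her per-round budget `ρL`; the
optimizer's expected spending, averaged over the phases, is at most `ρO` per round. (An optimizer's
payment that is not integrable has infinite expectation, hence is not feasible.) -/
def bseValues (a : AuctionFormat) (D : Measure ValuePair) (ρO ρL : ℝ) : Set ℝ :=
  {x | ∃ (k : ℕ) (w lam : Fin k → ℝ) (κ : Fin k → Kernel unitInterval ℝ≥0),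
    (∀ i, 0 ≤ w i) ∧ ∑ i, w i = 1 ∧
    (∀ i, 0 ≤ lam i) ∧
    (∀ i, IsMarkovKernel (κ i)) ∧
    (∀ i, Integrable (fun y : ValuePair × ℝ≥0 => payO a y.2 y.1) (roundLaw D (κ i))) ∧
    (∀ i, ρL ≤ lam i * expPayL a D (κ i)) ∧
    ∑ i, w i * (lam i * expPayO a D (κ i)) ≤ ρO ∧
    x = ∑ i, w i * expValO D (κ i)}

/-- `OPT`, the optimizer's BSE value per round. -/
def bseOpt (a : AuctionFormat) (D : Measure ValuePair) (ρO ρL : ℝ) : ℝ :=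
  sSup (bseValues a D ρO ρL)

/-! ### The repeated game -/

/-- A strategy of the optimizer in the repeated game. Rounds are numbered from `0`; `bid t s h v_O`
is the normalized bid in round `t`, given the private random seed `s`, the value pairs `h` of the
rounds before `t`, and the optimizer's current value `v_O`. -/
structure OptStrategy (S : Type) [MeasurableSpace S] where
  bid : (t : ℕ) → S → (Fin t → ValuePair) → unitInterval → ℝ≥0
  measurable_bid : ∀ t, Measurable
    (fun p : S × (Fin t → ValuePair) × unitInterval => bid t p.1 p.2.1 p.2.2)

namespace OptStrategy

variable {S : Type} [MeasurableSpace S]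

/-- The normalized bid that is submitted in round `t` when the seed is `s` and the sequence of
value pairs is `v`. -/
def bidAt (B : OptStrategy S) (s : S) (v : ℕ → ValuePair) (t : ℕ) : ℝ≥0 :=
  B.bid t s (fun i : Fin t => v i) (v t).2

/-- The learner's multiplier in each round: it starts at `lam1` and is updated by
`lam ← lam + η * (ρL - lam * P_L)`. -/
def multiplier (B : OptStrategy S) (a : AuctionFormat) (ρL η lam1 : ℝ) (s : S)
    (v : ℕ → ValuePair) : ℕ → ℝ
  | 0 => lam1
  | t + 1 =>
    multiplier B a ρL η lam1 s v t +
      η * (ρL - multiplier B a ρL η lam1 s v t * payL a (B.bidAt s v t) (v t))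

/-- The optimizer's total value in the first `T` rounds. -/
def totalValue (B : OptStrategy S) (T : ℕ) (s : S) (v : ℕ → ValuePair) : ℝ :=
  ∑ t ∈ Finset.range T, valO (B.bidAt s v t) (v t)

/-- The optimizer's total payment in the first `T` rounds. -/
def totalPayment (B : OptStrategy S) (a : AuctionFormat) (ρL η lam1 : ℝ) (T : ℕ) (s : S)
    (v : ℕ → ValuePair) : ℝ :=
  ∑ t ∈ Finset.range T,
    B.multiplier a ρL η lam1 s v t * payO a (B.bidAt s v t) (v t)

end OptStrategy

/-- The expected total values that an optimizer with budget `ρO * T` can get in `T` rounds against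
the learner with target spending `ρL`, step size `η` and initial multiplier `lam1`, when the value
pairs are i.i.d. with law `D`: the budget must hold almost surely. -/
def achievableValues (a : AuctionFormat) (D : Measure ValuePair) [IsProbabilityMeasure D]
    (ρO ρL η lam1 : ℝ) (T : ℕ) : Set ℝ :=
  {x | ∃ (S : Type) (_ : MeasurableSpace S) (ν : Measure S) (_ : IsProbabilityMeasure ν)
    (B : OptStrategy S),
    (∀ᵐ p ∂(ν.prod (Measure.infinitePi (fun _ : ℕ => D))),
      B.totalPayment a ρL η lam1 T p.1 p.2 ≤ ρO * T) ∧
    x = ∫ p, B.totalValue T p.1 p.2 ∂(ν.prod (Measure.infinitePi (fun _ : ℕ => D)))}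

end

/-!
The proof is by Lagrangian duality: prices for the two budgets certify `OPT` in one round, and a
potential built from the learner's prices carries the certificate over to the repeated game.

*One round.* The outcomes `(U, O, L)` (the optimizer's value and the normalized payments of the
optimizer and the learner) of mixtures of bidding functions form a convex set `outcomes`. Since
`OPT` allows mixing over multipliers, the optimizer's budget has a price `μ ≥ 0`:
`U - μ l O ≤ A := OPT - μ ρO` for every multiplier `l` and every outcome with `l L ≥ ρL`
(`exists_budget_price`). For fixed `l`, convexity of `outcomes` turns the constraint `l L ≥ ρL` into
a price `ν l ≥ 0`: `U - μ l O + ν l (l L - ρL) ≤ A` for all outcomes (`exists_learner_prices`).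

Two facts make the prices `ν` usable. They are bounded: if `l L < ρL`, then the same outcome is
feasible at the multiplier `ρL / L`, which raises the optimizer's priced payment only by a multiple
of the deficit `ρL - l L` (and a deficit above `ρL / 2` is no concern, as values are at most `1`).
And they vanish for large `l` if `μ > 0`: by the assumption on `D`, value beyond that of the free
rounds, those with `v_L = 0`, costs at least `ε l` per unit, while the free rounds alone are worth
at most `A`. If `μ = 0`, no outcome is worth more than `OPT`, and all prices can be `0`.

*Repeated game.* Averaging `ν` over windows of length `σ` gives prices `f` that are Lipschitz with a
constant of order `1 / σ`, and are valid up to `O(σ)` (`exists_lipschitz_average`). Sum the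
one-round inequality along the play. The optimizer's payments are covered by her budget. The
learner's terms are `f(λ) (ρL - λ P_L) = f(λ) (λ' - λ) / η` with `λ'` the next multiplier, so they
telescope with the primitive of `f` as a potential, up to `O(η² / σ) / η` per round
(`sum_price_mul_error_le`). As the bidding function of a round does not depend on the values of that
round, the one-round inequality holds for each round given the past
(`OptStrategy.integral_lagrangian_le`). In total the excess is `O(σ T + η T / σ + 1 / η)`; the other
two claims follow by choosing `σ = T ^ (-1/3)` and `σ = √η`.
-/

/-! ### One round -/

theorem measurable_valO : Measurable (fun x : ValuePair × ℝ≥0 => valO x.2 x.1) := by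
  unfold valO
  refine Measurable.ite (measurableSet_lt ?_ ?_) ?_ ?_ <;> fun_prop

theorem measurable_payO (a : AuctionFormat) :
    Measurable (fun x : ValuePair × ℝ≥0 => payO a x.2 x.1) := by
  unfold payO
  refine Measurable.ite (measurableSet_lt ?_ ?_) ?_ ?_
  · fun_prop
  · fun_prop
  · cases a <;> simp only <;> fun_prop
  · fun_prop

theorem measurable_payL (a : AuctionFormat) :
    Measurable (fun x : ValuePair × ℝ≥0 => payL a x.2 x.1) := by
  unfold payL
  refine Measurable.ite (measurableSet_lt ?_ ?_) ?_ ?_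
  · fun_prop
  · fun_prop
  · fun_prop
  · cases a <;> simp only <;> fun_prop

theorem valO_nonneg (b : ℝ≥0) (v : ValuePair) : 0 ≤ valO b v := by
  unfold valO; split_ifs <;> [exact v.2.2.1; exact le_rfl]

theorem valO_le_value (b : ℝ≥0) (v : ValuePair) : valO b v ≤ v.2 := by
  unfold valO; split_ifs <;> [exact le_rfl; exact v.2.2.1]

theorem valO_le_one (b : ℝ≥0) (v : ValuePair) : valO b v ≤ 1 :=
  (valO_le_value b v).trans v.2.2.2

theorem payO_nonneg (a : AuctionFormat) (b : ℝ≥0) (v : ValuePair) : 0 ≤ payO a b v := by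
  unfold payO; split_ifs
  · cases a <;> [exact b.2; exact v.1.2.1]
  · exact le_rfl

theorem payO_le_bid (a : AuctionFormat) (b : ℝ≥0) (v : ValuePair) : payO a b v ≤ b := by
  unfold payO; split_ifs with h
  · cases a <;> [exact le_rfl; exact h.le]
  · exact b.2

theorem payL_nonneg (a : AuctionFormat) (b : ℝ≥0) (v : ValuePair) : 0 ≤ payL a b v := by
  unfold payL; split_ifs
  · exact le_rfl
  · cases a <;> [exact v.1.2.1; exact b.2]

theorem payL_le_one (a : AuctionFormat) (b : ℝ≥0) (v : ValuePair) : payL a b v ≤ 1 := by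
  unfold payL; split_ifs with h
  · exact zero_le_one
  · cases a <;> [exact v.1.2.2; exact (not_lt.1 h).trans v.1.2.2]

/-- Capping the bid at `2`, above all values of the learner, does not change the winner. -/
theorem lt_min_two_iff (b : ℝ≥0) (x : unitInterval) :
    (x : ℝ) < ((min b 2 : ℝ≥0) : ℝ) ↔ (x : ℝ) < b := by
  have := x.2.2
  rw [NNReal.coe_min, lt_min_iff]
  exact ⟨fun h => h.1, fun h => ⟨h, by norm_num; linarith⟩⟩

theorem valO_min_two (b : ℝ≥0) (v : ValuePair) : valO (min b 2) v = valO b v := by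
  unfold valO; simp only [lt_min_two_iff]

theorem payL_min_two (a : AuctionFormat) (b : ℝ≥0) (v : ValuePair) :
    payL a (min b 2) v = payL a b v := by
  have := v.1.2.2
  unfold payL; simp only [lt_min_two_iff]
  split_ifs with h
  · rfl
  · cases a
    · rfl
    · have hb : (b : ℝ) ≤ 2 := by linarith
      simp only [min_eq_left (show b ≤ 2 from by exact_mod_cast hb)]

theorem payO_min_two_le (a : AuctionFormat) (b : ℝ≥0) (v : ValuePair) :
    payO a (min b 2) v ≤ payO a b v := by
  unfold payO; simp only [lt_min_two_iff]
  split_ifs with h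
  · cases a
    · exact_mod_cast min_le_left b 2
    · exact le_rfl
  · exact le_rfl

/-- If the learner's positive values are at least `ε v_O`, then a win against a positive value
costs at least `ε v_O`; only wins against the value `0` can be cheaper. -/
theorem valO_le_of_margin (a : AuctionFormat) {ε : ℝ} (hε : 0 < ε) (b : ℝ≥0) (v : ValuePair)
    (hv : ¬ (0 < (v.1 : ℝ) ∧ (v.1 : ℝ) < ε * (v.2 : ℝ))) :
    valO b v ≤ (if (v.1 : ℝ) = 0 then (v.2 : ℝ) else 0) + payO a b v / ε := by
  have hO : 0 ≤ payO a b v / ε := div_nonneg (payO_nonneg a b v) hε.le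
  by_cases h0 : (v.1 : ℝ) = 0
  · rw [if_pos h0]; linarith [valO_le_value b v]
  rw [if_neg h0, zero_add]
  by_cases h : (v.1 : ℝ) < b
  · have hpos : 0 < (v.1 : ℝ) := lt_of_le_of_ne v.1.2.1 (Ne.symm h0)
    have hle : ε * (v.2 : ℝ) ≤ v.1 := by
      by_contra hc; exact hv ⟨hpos, not_le.1 hc⟩
    rw [le_div_iff₀ hε]
    have : (v.1 : ℝ) ≤ payO a b v := by
      unfold payO; rw [if_pos h]; cases a <;> [exact h.le; exact le_rfl]
    unfold valO; rw [if_pos h]; linarith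
  · unfold valO; rw [if_neg h]; exact hO

/-! ### The convex set of one-round outcomes -/

/-- The outcome `(U_O, P_O, P_L)` of a deterministic bidding function. -/
noncomputable def detOutcome (a : AuctionFormat) (D : Measure ValuePair)
    (β : unitInterval → ℝ≥0) : ℝ × ℝ × ℝ :=
  (∫ v, valO (β v.2) v ∂D, ∫ v, payO a (β v.2) v ∂D, ∫ v, payL a (β v.2) v ∂D)

/-- The outcomes `(U_O, P_O, P_L)` of finite mixtures of deterministic measurable bidding
functions. Normalized bids are at most `2`, so that all payments are bounded; higher bids never
help the optimizer. -/
def outcomes (a : AuctionFormat) (D : Measure ValuePair) : Set (ℝ × ℝ × ℝ) :=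
  convexHull ℝ {p | ∃ β : unitInterval → ℝ≥0, Measurable β ∧ (∀ x, β x ≤ 2) ∧
    p = detOutcome a D β}

theorem detOutcome_mem_outcomes (a : AuctionFormat) (D : Measure ValuePair)
    {β : unitInterval → ℝ≥0} (hβ : Measurable β) (hβ2 : ∀ x, β x ≤ 2) :
    detOutcome a D β ∈ outcomes a D :=
  subset_convexHull ℝ _ ⟨β, hβ, hβ2, rfl⟩

section Outcomes

variable (a : AuctionFormat) (D : Measure ValuePair) [IsProbabilityMeasure D]

theorem integrable_valO_bid {β : unitInterval → ℝ≥0} (hβ : Measurable β) :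
    Integrable (fun v : ValuePair => valO (β v.2) v) D := by
  refine Integrable.of_bound (C := 1) ?_ (ae_of_all _ fun v => ?_)
  · exact (measurable_valO.comp
      (measurable_id.prodMk (hβ.comp measurable_snd))).aestronglyMeasurable
  · rw [Real.norm_of_nonneg (valO_nonneg _ _)]; exact valO_le_one _ _

theorem integrable_payL_bid {β : unitInterval → ℝ≥0} (hβ : Measurable β) :
    Integrable (fun v : ValuePair => payL a (β v.2) v) D := by
  refine Integrable.of_bound (C := 1) ?_ (ae_of_all _ fun v => ?_)
  · exact ((measurable_payL a).comp
      (measurable_id.prodMk (hβ.comp measurable_snd))).aestronglyMeasurable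
  · rw [Real.norm_of_nonneg (payL_nonneg _ _ _)]; exact payL_le_one _ _ _

theorem integrable_payO_bid {β : unitInterval → ℝ≥0} (hβ : Measurable β) (hβ2 : ∀ x, β x ≤ 2) :
    Integrable (fun v : ValuePair => payO a (β v.2) v) D := by
  refine Integrable.of_bound (C := 2) ?_ (ae_of_all _ fun v => ?_)
  · exact ((measurable_payO a).comp
      (measurable_id.prodMk (hβ.comp measurable_snd))).aestronglyMeasurable
  · rw [Real.norm_of_nonneg (payO_nonneg _ _ _)]
    exact (payO_le_bid _ _ _).trans (by exact_mod_cast hβ2 _)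

/-- `Z`: the expected value of the rounds that the learner values at `0`. These can be won
essentially for free. -/
noncomputable def freeValue : ℝ :=
  ∫ v : ValuePair, (if (v.1 : ℝ) = 0 then (v.2 : ℝ) else 0) ∂D

theorem integrable_free :
    Integrable (fun v : ValuePair => if (v.1 : ℝ) = 0 then (v.2 : ℝ) else 0) D := by
  refine Integrable.of_bound (C := 1) ?_ (ae_of_all _ fun v => ?_)
  · refine (Measurable.ite (measurableSet_eq_fun ?_ ?_) ?_ ?_).aestronglyMeasurable <;> fun_prop
  · split_ifs
    · rw [Real.norm_of_nonneg v.2.2.1]; exact v.2.2.2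
    · simp

theorem outcomes_bounds {p : ℝ × ℝ × ℝ} (hp : p ∈ outcomes a D) :
    (0 ≤ p.1 ∧ p.1 ≤ 1) ∧ (0 ≤ p.2.1 ∧ p.2.1 ≤ 2) ∧ (0 ≤ p.2.2 ∧ p.2.2 ≤ 1) := by
  have hconv : Convex ℝ (Set.Icc (0 : ℝ) 1 ×ˢ (Set.Icc (0 : ℝ) 2 ×ˢ Set.Icc (0 : ℝ) 1)) :=
    (convex_Icc 0 1).prod ((convex_Icc 0 2).prod (convex_Icc 0 1))
  refine convexHull_min ?_ hconv hp
  rintro _ ⟨β, hβ, hβ2, rfl⟩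
  refine ⟨⟨integral_nonneg fun v => valO_nonneg _ _, ?_⟩,
    ⟨integral_nonneg fun v => payO_nonneg _ _ _, ?_⟩,
    ⟨integral_nonneg fun v => payL_nonneg _ _ _, ?_⟩⟩
  · simpa [detOutcome] using integral_mono (integrable_valO_bid D hβ) (integrable_const 1)
      fun v => valO_le_one _ _
  · simpa [detOutcome] using integral_mono (integrable_payO_bid a D hβ hβ2) (integrable_const 2)
      fun v => (payO_le_bid a _ _).trans (by exact_mod_cast hβ2 v.2)
  · simpa [detOutcome] using integral_mono (integrable_payL_bid a D hβ) (integrable_const 1)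
      fun v => payL_le_one _ _ _

/-- Value beyond the free value `Z` costs at least `ε` per unit. -/
theorem outcomes_margin {ε : ℝ} (hε : 0 < ε)
    (hD : D {v : ValuePair | 0 < (v.1 : ℝ) ∧ (v.1 : ℝ) < ε * (v.2 : ℝ)} = 0)
    {p : ℝ × ℝ × ℝ} (hp : p ∈ outcomes a D) : p.1 ≤ freeValue D + p.2.1 / ε := by
  have hconv : Convex ℝ {q : ℝ × ℝ × ℝ | q.1 ≤ freeValue D + q.2.1 / ε} := by
    intro x hx y hy s t hs ht hst
    simp only [Set.mem_ofPred_eq, Prod.fst_add, Prod.snd_add, Prod.smul_fst, Prod.smul_snd,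
      smul_eq_mul] at *
    have h1 := mul_le_mul_of_nonneg_left hx hs
    have h2 := mul_le_mul_of_nonneg_left hy ht
    have h3 : (s * x.2.1 + t * y.2.1) / ε = s * (x.2.1 / ε) + t * (y.2.1 / ε) := by ring
    have h4 : freeValue D = s * freeValue D + t * freeValue D := by rw [← add_mul, hst, one_mul]
    rw [h3]; linarith
  refine convexHull_min ?_ hconv hp
  rintro _ ⟨β, hβ, hβ2, rfl⟩
  have hi := (integrable_payO_bid a D hβ hβ2).div_const ε
  have := integral_mono_ae (integrable_valO_bid D hβ) ((integrable_free D).add hi)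
    (show ∀ᵐ v ∂D, _ from by
      filter_upwards [measure_eq_zero_iff_ae_notMem.1 hD] with v hv
      exact valO_le_of_margin a hε _ _ hv)
  rw [integral_add' (integrable_free D) hi, integral_div] at this
  exact this

/-- The mixture of two random bidding functions. -/
noncomputable def mixKernel (s t : ℝ≥0) (κ₁ κ₂ : Kernel unitInterval ℝ≥0) :
    Kernel unitInterval ℝ≥0 where
  toFun x := s • κ₁ x + t • κ₂ x
  measurable' := Measure.measurable_of_measurable_coe _ fun _ hA =>
    ((κ₁.measurable_coe hA).const_smul s).add ((κ₂.measurable_coe hA).const_smul t)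

theorem mixKernel_apply (s t : ℝ≥0) (κ₁ κ₂ : Kernel unitInterval ℝ≥0) (x : unitInterval) :
    mixKernel s t κ₁ κ₂ x = s • κ₁ x + t • κ₂ x := rfl

theorem isMarkovKernel_mixKernel {s t : ℝ≥0} (hst : s + t = 1) (κ₁ κ₂ : Kernel unitInterval ℝ≥0)
    [IsMarkovKernel κ₁] [IsMarkovKernel κ₂] : IsMarkovKernel (mixKernel s t κ₁ κ₂) := by
  refine ⟨fun x => ⟨?_⟩⟩
  rw [mixKernel_apply]
  simp only [Measure.coe_add, Pi.add_apply, Measure.smul_apply, measure_univ]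
  simp only [ENNReal.smul_def, smul_eq_mul, mul_one]
  exact_mod_cast hst

theorem roundLaw_mixKernel {s t : ℝ≥0} (hst : s + t = 1) (κ₁ κ₂ : Kernel unitInterval ℝ≥0)
    [IsMarkovKernel κ₁] [IsMarkovKernel κ₂] :
    roundLaw D (mixKernel s t κ₁ κ₂) = s • roundLaw D κ₁ + t • roundLaw D κ₂ := by
  have := isMarkovKernel_mixKernel hst κ₁ κ₂
  ext A hA
  unfold roundLaw
  simp only [Measure.coe_add, Pi.add_apply, Measure.smul_apply, Measure.compProd_apply hA,
    ENNReal.smul_def, smul_eq_mul, Kernel.comap_apply, mixKernel_apply]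
  have h1 : ∀ κ : Kernel unitInterval ℝ≥0, IsMarkovKernel κ →
      Measurable fun v : ValuePair => κ v.2 (Prod.mk v ⁻¹' A) := fun κ _ =>
    Kernel.measurable_kernel_prodMk_left (κ := κ.comap Prod.snd measurable_snd) hA
  rw [lintegral_add_left ((h1 κ₁ inferInstance).const_mul _),
    lintegral_const_mul _ (h1 κ₁ inferInstance), lintegral_const_mul _ (h1 κ₂ inferInstance)]

theorem roundLaw_deterministic {β : unitInterval → ℝ≥0} (hβ : Measurable β) :
    roundLaw D (Kernel.deterministic β hβ) = D.map (fun v => (v, β v.2)) := by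
  have hm : Measurable (fun v : ValuePair => (v, β v.2)) :=
    measurable_id.prodMk (hβ.comp measurable_snd)
  have hs : Measurable (Prod.snd : ValuePair → unitInterval) := measurable_snd
  have : (Kernel.deterministic β hβ).comap Prod.snd hs =
      Kernel.deterministic (fun v : ValuePair => β v.2) (hβ.comp hs) := by
    ext v : 1
    rw [Kernel.comap_apply, Kernel.deterministic_apply, Kernel.deterministic_apply]
  rw [roundLaw, this, Measure.compProd_deterministic]

instance isProbabilityMeasure_roundLaw (κ : Kernel unitInterval ℝ≥0) [IsMarkovKernel κ] :
    IsProbabilityMeasure (roundLaw D κ) := by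
  unfold roundLaw; infer_instance

/-- Every outcome is the outcome of a random bidding function. -/
theorem exists_kernel_of_mem_outcomes {p : ℝ × ℝ × ℝ} (hp : p ∈ outcomes a D) :
    ∃ κ : Kernel unitInterval ℝ≥0, IsMarkovKernel κ ∧
      Integrable (fun y : ValuePair × ℝ≥0 => payO a y.2 y.1) (roundLaw D κ) ∧
      p = (expValO D κ, expPayO a D κ, expPayL a D κ) := by
  have hconv : Convex ℝ {p : ℝ × ℝ × ℝ | ∃ κ : Kernel unitInterval ℝ≥0, IsMarkovKernel κ ∧
      Integrable (fun y : ValuePair × ℝ≥0 => payO a y.2 y.1) (roundLaw D κ) ∧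
      p = (expValO D κ, expPayO a D κ, expPayL a D κ)} := by
    rintro _ ⟨κ₁, _, h₁, rfl⟩ _ ⟨κ₂, _, h₂, rfl⟩ s t hs ht hst
    lift s to ℝ≥0 using hs
    lift t to ℝ≥0 using ht
    have hst' : s + t = 1 := by exact_mod_cast hst
    have hU : ∀ κ : Kernel unitInterval ℝ≥0, IsMarkovKernel κ →
        Integrable (fun y : ValuePair × ℝ≥0 => valO y.2 y.1) (roundLaw D κ) := fun κ _ =>
      Integrable.of_bound (C := 1) measurable_valO.aestronglyMeasurable (ae_of_all _ fun v => by
        rw [Real.norm_of_nonneg (valO_nonneg _ _)]; exact valO_le_one _ _)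
    have hL : ∀ κ : Kernel unitInterval ℝ≥0, IsMarkovKernel κ →
        Integrable (fun y : ValuePair × ℝ≥0 => payL a y.2 y.1) (roundLaw D κ) := fun κ _ =>
      Integrable.of_bound (C := 1) (measurable_payL a).aestronglyMeasurable (ae_of_all _ fun v => by
        rw [Real.norm_of_nonneg (payL_nonneg _ _ _)]; exact payL_le_one _ _ _)
    have key : ∀ f : ValuePair × ℝ≥0 → ℝ, Integrable f (roundLaw D κ₁) →
        Integrable f (roundLaw D κ₂) →
        Integrable f (roundLaw D (mixKernel s t κ₁ κ₂)) ∧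
        ∫ x, f x ∂(roundLaw D (mixKernel s t κ₁ κ₂)) =
          s * ∫ x, f x ∂(roundLaw D κ₁) + t * ∫ x, f x ∂(roundLaw D κ₂) := by
      intro f hf1 hf2
      have g1 : Integrable f (s • roundLaw D κ₁) := hf1.smul_measure_nnreal
      have g2 : Integrable f (t • roundLaw D κ₂) := hf2.smul_measure_nnreal
      rw [roundLaw_mixKernel D hst']
      refine ⟨g1.add_measure g2, ?_⟩
      rw [integral_add_measure g1 g2, integral_smul_nnreal_measure, integral_smul_nnreal_measure]
      rfl
    refine ⟨mixKernel s t κ₁ κ₂, isMarkovKernel_mixKernel hst' κ₁ κ₂, (key _ h₁ h₂).1, ?_⟩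
    unfold expValO expPayO expPayL
    rw [(key _ (hU κ₁ ‹_›) (hU κ₂ ‹_›)).2, (key _ h₁ h₂).2, (key _ (hL κ₁ ‹_›) (hL κ₂ ‹_›)).2]
    rfl
  refine convexHull_min ?_ hconv hp
  rintro _ ⟨β, hβ, hβ2, rfl⟩
  have hm : Measurable (fun v : ValuePair => (v, β v.2)) :=
    measurable_id.prodMk (hβ.comp measurable_snd)
  refine ⟨Kernel.deterministic β hβ, inferInstance, ?_, ?_⟩
  · rw [roundLaw_deterministic]
    exact (integrable_map_measure (measurable_payO a).aestronglyMeasurable hm.aemeasurable).2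
      (integrable_payO_bid a D hβ hβ2)
  · unfold expValO expPayO expPayL
    rw [roundLaw_deterministic, integral_map hm.aemeasurable measurable_valO.aestronglyMeasurable,
      integral_map hm.aemeasurable (measurable_payO a).aestronglyMeasurable,
      integral_map hm.aemeasurable (measurable_payL a).aestronglyMeasurable]
    rfl

end Outcomes

/-! ### Lagrange multipliers -/

/-- One-dimensional Lagrangian duality. If no point and no segment of `S` over the half-line
`0 ≤ x` rises above height `0`, then a line through the origin of slope `-ν` with `ν ≥ 0` lies
above `S`; its slope is bounded by any slope `M` that suffices over `x < 0`. -/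
theorem exists_multiplier {S : Set (ℝ × ℝ)} {M : ℝ} (hM : 0 ≤ M)
    (hS : ∀ p ∈ S, ∀ q ∈ S, ∀ s t : ℝ, 0 ≤ s → 0 ≤ t → s + t = 1 →
      0 ≤ s * p.1 + t * q.1 → s * p.2 + t * q.2 ≤ 0)
    (hneg : ∀ p ∈ S, p.1 < 0 → p.2 ≤ M * -p.1) :
    ∃ ν : ℝ, 0 ≤ ν ∧ ν ≤ M ∧ ∀ p ∈ S, p.2 + ν * p.1 ≤ 0 := by
  set R : Set ℝ := insert 0 {r | ∃ p ∈ S, p.1 < 0 ∧ r = p.2 / -p.1} with hR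
  have hub : ∀ r ∈ R, r ≤ M := by
    rintro r (rfl | ⟨p, hp, h, rfl⟩)
    · exact hM
    · exact (div_le_iff₀ (by linarith)).2 (hneg p hp h)
  have hb : BddAbove R := ⟨M, hub⟩
  have h0 : (0 : ℝ) ∈ R := Set.mem_insert _ _
  refine ⟨sSup R, le_csSup hb h0, csSup_le ⟨0, h0⟩ hub, fun p hp => ?_⟩
  rcases lt_trichotomy p.1 0 with h | h | h
  · have : p.2 / -p.1 ≤ sSup R := le_csSup hb (Or.inr ⟨p, hp, h, rfl⟩)
    rw [div_le_iff₀ (by linarith)] at this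
    linarith
  · have := hS p hp p hp 1 0 zero_le_one le_rfl (by norm_num) (by simp [h])
    rw [h]; linarith
  · have hpp := hS p hp p hp 1 0 zero_le_one le_rfl (by norm_num) (by simp [h.le])
    have : sSup R ≤ -p.2 / p.1 := by
      refine csSup_le ⟨0, h0⟩ ?_
      rintro r (rfl | ⟨q, hq, hq0, rfl⟩)
      · exact div_nonneg (by linarith) h.le
      · -- The segment from `q` to `p` crosses the axis `x = 0` at a height of at most `0`.
        have hd : 0 < p.1 - q.1 := by linarith
        have := hS p hp q hq (-q.1 / (p.1 - q.1)) (p.1 / (p.1 - q.1))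
          (div_nonneg (by linarith) hd.le) (div_nonneg h.le hd.le)
          (by field_simp; ring) (by apply le_of_eq; field_simp; ring)
        have h2 : -q.1 / (p.1 - q.1) * p.2 + p.1 / (p.1 - q.1) * q.2 =
            (-q.1 * p.2 + p.1 * q.2) / (p.1 - q.1) := by ring
        rw [h2, div_nonpos_iff] at this
        rw [div_le_div_iff₀ (by linarith) h]
        rcases this with h' | h' <;> nlinarith [h'.1, h'.2]
    rw [le_div_iff₀ h] at this
    linarith

/-! ### The equilibrium value -/

section Opt

variable (a : AuctionFormat) (D : Measure ValuePair) [IsProbabilityMeasure D] {ρO ρL : ℝ}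

theorem expValO_le_one (κ : Kernel unitInterval ℝ≥0) [IsMarkovKernel κ] : expValO D κ ≤ 1 := by
  have hi : Integrable (fun y : ValuePair × ℝ≥0 => valO y.2 y.1) (roundLaw D κ) :=
    Integrable.of_bound (C := 1) measurable_valO.aestronglyMeasurable (ae_of_all _ fun v => by
      rw [Real.norm_of_nonneg (valO_nonneg _ _)]; exact valO_le_one _ _)
  simpa [expValO] using integral_mono hi (integrable_const 1) fun v => valO_le_one _ _

theorem bddAbove_bseValues : BddAbove (bseValues a D ρO ρL) := by
  refine ⟨1, ?_⟩
  rintro _ ⟨k, w, lam, κ, hw, hw1, -, hκ, -, -, -, rfl⟩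
  calc ∑ i, w i * expValO D (κ i) ≤ ∑ i, w i * 1 :=
        Finset.sum_le_sum fun i _ =>
          have := hκ i; mul_le_mul_of_nonneg_left (expValO_le_one D (κ i)) (hw i)
    _ = 1 := by simpa using hw1

/-- Feasible combinations of two phases are worth at most `OPT`. -/
theorem two_phase_le_bseOpt {p q : ℝ × ℝ × ℝ} (hp : p ∈ outcomes a D) (hq : q ∈ outcomes a D)
    {l m s t : ℝ} (hl : 0 ≤ l) (hm : 0 ≤ m) (hs : 0 ≤ s) (ht : 0 ≤ t) (hst : s + t = 1)
    (hpL : ρL ≤ l * p.2.2) (hqL : ρL ≤ m * q.2.2)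
    (hO : s * (l * p.2.1) + t * (m * q.2.1) ≤ ρO) :
    s * p.1 + t * q.1 ≤ bseOpt a D ρO ρL := by
  obtain ⟨κ₁, hκ₁, hi₁, rfl⟩ := exists_kernel_of_mem_outcomes a D hp
  obtain ⟨κ₂, hκ₂, hi₂, rfl⟩ := exists_kernel_of_mem_outcomes a D hq
  refine le_csSup (bddAbove_bseValues a D) ⟨2, ![s, t], ![l, m], ![κ₁, κ₂], ?_, ?_, ?_, ?_, ?_, ?_,
    ?_, ?_⟩
  · intro i; fin_cases i <;> assumption
  · simpa [Fin.sum_univ_two] using hst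
  · intro i; fin_cases i <;> assumption
  · intro i; fin_cases i <;> assumption
  · intro i; fin_cases i <;> assumption
  · intro i; fin_cases i <;> assumption
  · simpa [Fin.sum_univ_two] using hO
  · simp [Fin.sum_univ_two]

theorem measurableSet_low_values (d : ℝ) :
    MeasurableSet {v : ValuePair | 0 < (v.1 : ℝ) ∧ (v.1 : ℝ) < d} := by
  have hm : Measurable fun v : ValuePair => (v.1 : ℝ) := by fun_prop
  exact hm measurableSet_Ioo

/-- Constant low bids win the free rounds, at a cost that is negligible compared with what the
learner pays. They show that the budget constraint has slack and that `OPT` is at least the free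
value. -/
theorem exists_cheap_outcome (hvL : 0 < ∫ v : ValuePair, (v.1 : ℝ) ∂D) {δ : ℝ} (hδ : 0 < δ) :
    ∃ p ∈ outcomes a D, 0 < p.2.2 ∧ freeValue D ≤ p.1 ∧ p.2.1 ≤ δ * p.2.2 := by
  -- Some threshold `c > 0` is reached with positive probability.
  obtain ⟨c, hc0, hc⟩ : ∃ c : ℝ, 0 < c ∧ 0 < D.real {v : ValuePair | c ≤ (v.1 : ℝ)} := by
    by_contra! hcon
    have hz : ∀ n : ℕ, ∀ᵐ v : ValuePair ∂D, (v.1 : ℝ) < 1 / ((n : ℝ) + 1) := fun n => by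
      have h1 := hcon (1 / ((n : ℝ) + 1)) (by positivity)
      have h2 : D {v : ValuePair | 1 / ((n : ℝ) + 1) ≤ (v.1 : ℝ)} = 0 :=
        (measureReal_eq_zero_iff).1 (le_antisymm h1 measureReal_nonneg)
      filter_upwards [measure_eq_zero_iff_ae_notMem.1 h2] with v hv
      exact not_le.1 hv
    have : (fun v : ValuePair => (v.1 : ℝ)) =ᵐ[D] 0 := by
      filter_upwards [ae_all_iff.2 hz] with v hv
      refine le_antisymm (le_of_forall_pos_lt_add fun e he => ?_) v.1.2.1
      obtain ⟨n, hn⟩ := exists_nat_one_div_lt he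
      simpa using (hv n).trans hn
    rw [integral_eq_zero_of_ae this] at hvL
    exact hvL.false
  set q := D.real {v : ValuePair | c ≤ (v.1 : ℝ)} with hq
  -- Values in `(0, b)` become improbable as `b → 0`.
  obtain ⟨d, hd0, hd⟩ : ∃ d : ℝ, 0 < d ∧
      D.real {v : ValuePair | 0 < (v.1 : ℝ) ∧ (v.1 : ℝ) < d} ≤ δ * q := by
    have hanti : Antitone fun n : ℕ =>
        {v : ValuePair | 0 < (v.1 : ℝ) ∧ (v.1 : ℝ) < 1 / ((n : ℝ) + 1)} := by
      intro m n hmn v hv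
      exact ⟨hv.1, hv.2.trans_le (one_div_le_one_div_of_le (by positivity) (by gcongr))⟩
    have hmeas : ∀ n : ℕ, NullMeasurableSet
        {v : ValuePair | 0 < (v.1 : ℝ) ∧ (v.1 : ℝ) < 1 / ((n : ℝ) + 1)} D := fun n =>
      (measurableSet_low_values _).nullMeasurableSet
    have hlim := tendsto_measure_iInter_atTop (μ := D) hmeas hanti ⟨0, measure_ne_top _ _⟩
    have hempty :
        (⋂ n : ℕ, {v : ValuePair | 0 < (v.1 : ℝ) ∧ (v.1 : ℝ) < 1 / ((n : ℝ) + 1)}) = ∅ := by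
      rw [Set.eq_empty_iff_forall_notMem]
      intro v hv
      rw [Set.mem_iInter] at hv
      obtain ⟨n, hn⟩ := exists_nat_one_div_lt (hv 0).1
      exact (hn.trans (hv n).2).false
    rw [hempty, measure_empty] at hlim
    have hlim' := (ENNReal.tendsto_toReal ENNReal.zero_ne_top).comp hlim
    obtain ⟨n, hn⟩ := (hlim'.eventually (gt_mem_nhds (show (0 : ENNReal).toReal < δ * q by
      simpa using mul_pos hδ hc))).exists
    exact ⟨1 / ((n : ℝ) + 1), by positivity, hn.le⟩
  -- A bid below `d` suits the second-price format, one below `δ c q` the first-price format.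
  set b : ℝ := min (min c d) (min 1 (δ * (c * q))) with hbdef
  have hb0 : 0 < b := by
    rw [hbdef]; exact lt_min (lt_min hc0 hd0) (lt_min one_pos (by positivity))
  have hbc : b ≤ c := (min_le_left _ _).trans (min_le_left _ _)
  have hbd : b ≤ d := (min_le_left _ _).trans (min_le_right _ _)
  have hb1 : b ≤ 1 := (min_le_right _ _).trans (min_le_left _ _)
  have hbq : b ≤ δ * (c * q) := (min_le_right _ _).trans (min_le_right _ _)
  set B : ℝ≥0 := ⟨b, hb0.le⟩ with hB
  have hBb : (B : ℝ) = b := rfl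
  have hβ : Measurable (fun _ : unitInterval => B) := measurable_const
  have hβ2 : ∀ x : unitInterval, (fun _ : unitInterval => B) x ≤ 2 := fun _ => by
    rw [← NNReal.coe_le_coe, hBb]; norm_num; linarith
  have hCm : MeasurableSet {v : ValuePair | c ≤ (v.1 : ℝ)} :=
    measurableSet_le measurable_const (by fun_prop)
  have hdm : MeasurableSet {v : ValuePair | 0 < (v.1 : ℝ) ∧ (v.1 : ℝ) < d} :=
    measurableSet_low_values d
  have hU : freeValue D ≤ ∫ v, valO B v ∂D := by
    refine integral_mono (integrable_free D) (integrable_valO_bid D hβ) fun v => ?_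
    by_cases h0 : (v.1 : ℝ) = 0
    · simp only [valO, h0, if_true]
      rw [if_pos (show (0 : ℝ) < B from hb0)]
    · simp only [if_neg h0]; exact valO_nonneg _ _
  refine ⟨_, detOutcome_mem_outcomes a D hβ hβ2, ?_, hU, ?_⟩ <;> simp only [detOutcome]
  all_goals
    have hLi := integrable_payL_bid a D hβ
    have hOi := integrable_payO_bid a D hβ hβ2
    cases a
  -- In each format `L` is bounded below by the contribution of the event `c ≤ v_L`.
  all_goals
    first
    | have hL : c * q ≤ ∫ v, payL .firstPrice B v ∂D := by
        have h := integral_mono ((integrable_const c).indicator hCm) hLi fun v => by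
          by_cases hv : v ∈ {v : ValuePair | c ≤ (v.1 : ℝ)}
          · rw [Set.indicator_of_mem hv]
            simp only [payL]
            rw [if_neg (by rw [hBb]; exact not_lt.2 (hbc.trans hv))]
            exact hv
          · rw [Set.indicator_of_notMem hv]; exact payL_nonneg _ _ _
        rwa [integral_indicator_const _ hCm, smul_eq_mul, mul_comm] at h
    | have hL : b * q ≤ ∫ v, payL .secondPrice B v ∂D := by
        have h := integral_mono ((integrable_const b).indicator hCm) hLi fun v => by
          by_cases hv : v ∈ {v : ValuePair | c ≤ (v.1 : ℝ)}
          · rw [Set.indicator_of_mem hv]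
            simp only [payL]
            rw [if_neg (by rw [hBb]; exact not_lt.2 (hbc.trans hv))]
            exact hBb.ge
          · rw [Set.indicator_of_notMem hv]; exact payL_nonneg _ _ _
        rwa [integral_indicator_const _ hCm, smul_eq_mul, mul_comm] at h
  · exact (mul_pos hc0 hc).trans_le hL
  · exact (mul_pos hb0 hc).trans_le hL
  · have h := integral_mono hOi (integrable_const b) fun v => payO_le_bid _ _ _
    rw [integral_const, probReal_univ, one_smul] at h
    exact h.trans (hbq.trans (mul_le_mul_of_nonneg_left hL hδ.le))
  · have h := integral_mono hOi ((integrable_const b).indicator hdm) fun v => by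
      by_cases hv : v ∈ {v : ValuePair | 0 < (v.1 : ℝ) ∧ (v.1 : ℝ) < d}
      · rw [Set.indicator_of_mem hv]; exact payO_le_bid _ _ _
      · rw [Set.indicator_of_notMem hv]
        simp only [payO]
        split_ifs with hlt
        · by_contra hpos
          exact hv ⟨not_le.1 hpos, hlt.trans_le (by rw [hBb]; exact hbd)⟩
        · exact le_rfl
    rw [integral_indicator_const _ hdm, smul_eq_mul] at h
    calc _ ≤ _ := h
      _ ≤ δ * q * b := mul_le_mul_of_nonneg_right hd hb0.le
      _ = δ * (b * q) := by ring
      _ ≤ _ := mul_le_mul_of_nonneg_left hL hδ.le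

end Opt

/-! ### Prices of the two budgets -/

section Prices

variable (a : AuctionFormat) (D : Measure ValuePair) [IsProbabilityMeasure D] {ρO ρL : ℝ}

/-- A price `μ` of the optimizer's budget: with payments charged at the price `μ`, no multiplier
and no bidding function under which the learner spends her budget beat the equilibrium value. -/
theorem exists_budget_price (hρO : 0 < ρO) (hρL : 0 < ρL)
    (hvL : 0 < ∫ v : ValuePair, (v.1 : ℝ) ∂D) :
    ∃ μ : ℝ, 0 ≤ μ ∧ ∀ l : ℝ, 0 ≤ l → ∀ p ∈ outcomes a D, ρL ≤ l * p.2.2 →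
      p.1 - μ * (l * p.2.1) ≤ bseOpt a D ρO ρL - μ * ρO := by
  obtain ⟨p₀, hp₀, hL₀, -, hO₀⟩ := exists_cheap_outcome a D hvL (div_pos hρO (mul_pos two_pos hρL))
  set l₀ := ρL / p₀.2.2 with hl₀
  have hl₀0 : 0 ≤ l₀ := by positivity
  have hl₀L : ρL ≤ l₀ * p₀.2.2 := by rw [hl₀, div_mul_cancel₀ _ hL₀.ne']
  have hslack : ρO / 2 ≤ ρO - l₀ * p₀.2.1 := by
    have h := mul_le_mul_of_nonneg_left hO₀ hl₀0
    have : l₀ * (ρO / (2 * ρL) * p₀.2.2) = ρO / 2 := by rw [hl₀]; field_simp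
    linarith
  set x₀ := ρO - l₀ * p₀.2.1 with hx₀
  have hx₀0 : 0 < x₀ := by linarith
  have hopt₀ : p₀.1 ≤ bseOpt a D ρO ρL := by
    have := two_phase_le_bseOpt a D hp₀ hp₀ hl₀0 hl₀0 zero_le_one le_rfl (by norm_num) hl₀L hl₀L
      (ρO := ρO) (by linarith)
    linarith
  set S : Set (ℝ × ℝ) := {z | ∃ l : ℝ, 0 ≤ l ∧ ∃ p ∈ outcomes a D, ρL ≤ l * p.2.2 ∧
    z = (ρO - l * p.2.1, p.1 - bseOpt a D ρO ρL)} with hSdef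
  have hS : ∀ p ∈ S, ∀ q ∈ S, ∀ s t : ℝ, 0 ≤ s → 0 ≤ t → s + t = 1 →
      0 ≤ s * p.1 + t * q.1 → s * p.2 + t * q.2 ≤ 0 := by
    rintro _ ⟨l, hl, p, hp, hpL, rfl⟩ _ ⟨m, hm, q, hq, hqL, rfl⟩ s t hs ht hst h
    simp only at h ⊢
    have hst' : ∀ x : ℝ, s * x + t * x = x := fun x => by rw [← add_mul, hst, one_mul]
    have := two_phase_le_bseOpt a D hp hq hl hm hs ht hst hpL hqL (ρO := ρO)
      (by linarith [hst' ρO])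
    linarith [hst' (bseOpt a D ρO ρL)]
  have hz₀ : (x₀, p₀.1 - bseOpt a D ρO ρL) ∈ S := ⟨l₀, hl₀0, p₀, hp₀, hl₀L, rfl⟩
  obtain ⟨μ, hμ, -, h⟩ := exists_multiplier (S := S)
    (M := (bseOpt a D ρO ρL - p₀.1) / x₀) (div_nonneg (by linarith) hx₀0.le) hS (by
      -- The slope is bounded by mixing with the outcome `p₀`, which leaves the budget slack `x₀`.
      intro z hz hz0
      have hd : 0 < x₀ - z.1 := by linarith
      have := hS z hz _ hz₀ (x₀ / (x₀ - z.1)) (-z.1 / (x₀ - z.1)) (div_nonneg hx₀0.le hd.le)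
        (div_nonneg (by linarith) hd.le) (by field_simp; ring)
        (by apply le_of_eq; field_simp; ring)
      have h2 : x₀ / (x₀ - z.1) * z.2 + -z.1 / (x₀ - z.1) * (p₀.1 - bseOpt a D ρO ρL) =
          (x₀ * z.2 + -z.1 * (p₀.1 - bseOpt a D ρO ρL)) / (x₀ - z.1) := by ring
      rw [h2, div_nonpos_iff] at this
      rw [div_mul_eq_mul_div, le_div_iff₀ hx₀0]
      rcases this with h' | h' <;> linarith [h'.1, h'.2])
  refine ⟨μ, hμ, fun l hl p hp hpL => ?_⟩
  have := h _ ⟨l, hl, p, hp, hpL, rfl⟩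
  simp only at this
  linarith

/-- If the budget has price `0`, then no outcome at all beats `OPT`: a large multiplier lets the
learner spend her budget in rare rounds, and the optimizer is unconstrained in all others. -/
theorem outcome_le_of_budget_price_zero {A : ℝ} (hρL : 0 < ρL)
    (hvL : 0 < ∫ v : ValuePair, (v.1 : ℝ) ∂D)
    (h : ∀ l : ℝ, 0 ≤ l → ∀ p ∈ outcomes a D, ρL ≤ l * p.2.2 → p.1 ≤ A)
    {p : ℝ × ℝ × ℝ} (hp : p ∈ outcomes a D) : p.1 ≤ A := by
  obtain ⟨p₀, hp₀, hL₀, -, -⟩ := exists_cheap_outcome a D hvL one_pos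
  have hb₀ := outcomes_bounds a D hp₀
  have hb := outcomes_bounds a D hp
  refine le_of_forall_pos_le_add fun δ hδ => ?_
  set s := min δ 1 with hs
  have hs0 : 0 < s := lt_min hδ one_pos
  have hs1 : s ≤ 1 := min_le_right _ _
  have hmix : s • p₀ + (1 - s) • p ∈ outcomes a D :=
    convex_convexHull ℝ _ hp₀ hp hs0.le (by linarith) (by ring)
  have hL : 0 < (s • p₀ + (1 - s) • p).2.2 := by
    simp only [Prod.snd_add, Prod.smul_snd, smul_eq_mul]
    have := mul_nonneg (sub_nonneg.2 hs1) hb.2.2.1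
    nlinarith
  have := h (ρL / (s • p₀ + (1 - s) • p).2.2) (by positivity) _ hmix
    (by rw [div_mul_cancel₀ _ hL.ne'])
  simp only [Prod.fst_add, Prod.smul_fst, smul_eq_mul] at this
  have h1 := mul_nonneg hs0.le hb₀.1.1
  have h2 := mul_le_mul_of_nonneg_left hb.1.2 hs0.le
  linarith [min_le_left δ 1]

/-- Free rounds are worth at most `OPT` net of the priced budget. -/
theorem freeValue_le {μ A : ℝ} (hμ : 0 ≤ μ) (hρL : 0 < ρL)
    (hvL : 0 < ∫ v : ValuePair, (v.1 : ℝ) ∂D)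
    (h : ∀ l : ℝ, 0 ≤ l → ∀ p ∈ outcomes a D, ρL ≤ l * p.2.2 → p.1 - μ * (l * p.2.1) ≤ A) :
    freeValue D ≤ A := by
  refine le_of_forall_pos_le_add fun δ hδ => ?_
  have hd : 0 < μ * ρL + 1 := by positivity
  obtain ⟨p, hp, hL, hU, hO⟩ := exists_cheap_outcome a D hvL (div_pos hδ hd)
  have h1 := h (ρL / p.2.2) (by positivity) p hp (by rw [div_mul_cancel₀ _ hL.ne'])
  have h2 : ρL / p.2.2 * p.2.1 ≤ ρL * (δ / (μ * ρL + 1)) := by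
    rw [div_mul_eq_mul_div, div_le_iff₀ hL]
    calc ρL * p.2.1 ≤ ρL * (δ / (μ * ρL + 1) * p.2.2) := mul_le_mul_of_nonneg_left hO hρL.le
      _ = _ := by ring
  have h3 : μ * (ρL * (δ / (μ * ρL + 1))) ≤ δ := by
    rw [show μ * (ρL * (δ / (μ * ρL + 1))) = (μ * ρL) * δ / (μ * ρL + 1) by ring,
      div_le_iff₀ hd]
    nlinarith
  have := mul_le_mul_of_nonneg_left h2 hμ
  linarith

/-- If the optimizer's budget has a positive price `μ`, there are prices `ν l` of the learner's
spending, one for each multiplier `l`. They are bounded, since an outcome under which the learner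
underspends at `l` makes her spend her budget at a slightly larger multiplier; and they vanish for
large `l`, where only free rounds are worth winning. -/
theorem exists_learner_prices {ε μ A : ℝ} (hε : 0 < ε) (hμ : 0 < μ) (hρL : 0 < ρL)
    (hD : D {v : ValuePair | 0 < (v.1 : ℝ) ∧ (v.1 : ℝ) < ε * (v.2 : ℝ)} = 0)
    (hvL : 0 < ∫ v : ValuePair, (v.1 : ℝ) ∂D)
    (h : ∀ l : ℝ, 0 ≤ l → ∀ p ∈ outcomes a D, ρL ≤ l * p.2.2 → p.1 - μ * (l * p.2.1) ≤ A) :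
    ∃ (M Λ : ℝ) (ν : ℝ → ℝ), 0 ≤ M ∧ 0 ≤ Λ ∧ (∀ l, 0 ≤ ν l ∧ ν l ≤ M) ∧ (∀ l, Λ ≤ l → ν l = 0) ∧
      ∀ l, 0 ≤ l → ∀ p ∈ outcomes a D, p.1 - μ * (l * p.2.1) + ν l * (l * p.2.2 - ρL) ≤ A := by
  have hZ := freeValue_le a D hμ.le hρL hvL h
  have hZ0 : 0 ≤ freeValue D := integral_nonneg fun v => by
    show 0 ≤ (if (v.1 : ℝ) = 0 then (v.2 : ℝ) else 0)
    split_ifs <;> [exact v.2.2.1; exact le_rfl]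
  set Λ := 1 / (μ * ε) with hΛ
  have hΛ0 : 0 < Λ := by positivity
  set M := 2 / ρL + 4 * μ * Λ / ρL with hM
  have hM0 : 0 ≤ M := by positivity
  have key : ∀ l : ℝ, ∃ ν : ℝ, 0 ≤ ν ∧ ν ≤ M ∧ (Λ ≤ l → ν = 0) ∧
      (0 ≤ l → ∀ p ∈ outcomes a D, p.1 - μ * (l * p.2.1) + ν * (l * p.2.2 - ρL) ≤ A) := by
    intro l
    rcases le_or_gt Λ l with hl | hl
    · refine ⟨0, le_rfl, hM0, fun _ => rfl, fun hl0 p hp => ?_⟩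
      have h1 := outcomes_margin a D hε hD hp
      have h2 : p.2.1 / ε ≤ μ * (l * p.2.1) := by
        have : μ * (Λ * p.2.1) = p.2.1 / ε := by rw [hΛ]; field_simp
        rw [← this]
        exact mul_le_mul_of_nonneg_left
          (mul_le_mul_of_nonneg_right hl (outcomes_bounds a D hp).2.1.1) hμ.le
      linarith
    rcases lt_or_ge l 0 with hl0 | hl0
    · exact ⟨0, le_rfl, hM0, fun _ => rfl, fun h => absurd h (not_le.2 hl0)⟩
    -- The set of pairs (the learner's overspending, the optimizer's priced excess value) is convex.
    obtain ⟨ν, hν0, hνM, hν⟩ := exists_multiplier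
      (S := {z | ∃ p ∈ outcomes a D, z = (l * p.2.2 - ρL, p.1 - μ * (l * p.2.1) - A)}) hM0 (by
        rintro _ ⟨p, hp, rfl⟩ _ ⟨q, hq, rfl⟩ s t hs ht hst hx
        have hmix := convex_convexHull ℝ _ hp hq hs ht hst
        have hst' : ∀ x : ℝ, s * x + t * x = x := fun x => by rw [← add_mul, hst, one_mul]
        have := h l hl0 _ hmix
        simp only [Prod.fst_add, Prod.snd_add, Prod.smul_fst, Prod.smul_snd, smul_eq_mul]
          at this hx ⊢
        have := this (by linarith [hst' ρL])
        linarith [hst' A]) (by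
        rintro _ ⟨p, hp, rfl⟩ hx
        simp only at hx ⊢
        obtain ⟨⟨hU0, hU1⟩, ⟨hO0, hO2⟩, ⟨hL0, hL1⟩⟩ := outcomes_bounds a D hp
        have hx' : 0 < ρL - l * p.2.2 := by linarith
        rw [neg_sub]
        have hlO : 0 ≤ μ * (l * p.2.1) := by positivity
        rcases le_or_gt (l * p.2.2) (ρL / 2) with hc | hc
        · have h1 : 1 ≤ 2 / ρL * (ρL - l * p.2.2) := by
            rw [div_mul_eq_mul_div, le_div_iff₀ hρL]; linarith
          have h2 : 0 ≤ 4 * μ * Λ / ρL * (ρL - l * p.2.2) := by positivity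
          rw [hM, add_mul]; linarith
        · -- Raise the multiplier until the learner spends her budget.
          have hL : 0 < p.2.2 := by
            rcases hL0.eq_or_lt with h0 | h0
            · rw [← h0, mul_zero] at hc; linarith
            · exact h0
          have h1 := h (ρL / p.2.2) (by positivity) p hp (by rw [div_mul_cancel₀ _ hL.ne'])
          have h2 : ρL / p.2.2 * p.2.1 - l * p.2.1 = p.2.1 / p.2.2 * (ρL - l * p.2.2) := by
            field_simp
          have h3 : p.2.1 / p.2.2 ≤ 4 * Λ / ρL := by
            rw [div_le_div_iff₀ hL hρL]
            have : ρL / 2 ≤ Λ * p.2.2 := hc.le.trans (mul_le_mul_of_nonneg_right hl.le hL0)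
            nlinarith
          have h4 : μ * (p.2.1 / p.2.2 * (ρL - l * p.2.2)) ≤
              4 * μ * Λ / ρL * (ρL - l * p.2.2) := by
            calc _ ≤ μ * (4 * Λ / ρL * (ρL - l * p.2.2)) :=
                  mul_le_mul_of_nonneg_left (mul_le_mul_of_nonneg_right h3 hx'.le) hμ.le
              _ = _ := by ring
          have h5 : 0 ≤ 2 / ρL * (ρL - l * p.2.2) := by positivity
          have h6 : μ * (ρL / p.2.2 * p.2.1) - μ * (l * p.2.1) =
              μ * (p.2.1 / p.2.2 * (ρL - l * p.2.2)) := by rw [← mul_sub, h2]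
          rw [hM, add_mul]; linarith)
    refine ⟨ν, hν0, hνM, fun h' => absurd h' (not_le.2 hl), fun _ p hp => ?_⟩
    have := hν _ ⟨p, hp, rfl⟩
    simp only at this
    linarith
  choose ν h1 h2 h3 h4 using key
  exact ⟨M, Λ, ν, hM0, hΛ0.le, fun l => ⟨h1 l, h2 l⟩, h3, h4⟩

end Prices

/-! ### Smoothed prices -/

/-- Averaging over windows of length `σ` makes a bounded function Lipschitz, up to rounding its
argument to the grid `σ ℤ`, which takes care of measurability. An inequality `c + ν l * d ≤ e` that
holds on the window `(x - σ, x + σ]` is inherited by the average at `x`. -/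
theorem exists_lipschitz_average {M Λ σ : ℝ} {ν : ℝ → ℝ} (hσ : 0 < σ)
    (hν : ∀ l, 0 ≤ ν l ∧ ν l ≤ M) (hνΛ : ∀ l, Λ ≤ l → ν l = 0) :
    ∃ f : ℝ → ℝ, (∀ x, 0 ≤ f x ∧ f x ≤ M) ∧ (∀ x, Λ + σ ≤ x → f x = 0) ∧
      (∀ x y, |f x - f y| ≤ M / σ * |x - y|) ∧
      ∀ x, 0 ≤ x → ∀ c d e : ℝ,
        (∀ l, 0 ≤ l → x - σ < l → l ≤ x + σ → c + ν l * d ≤ e) → c + f x * d ≤ e := by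
  set n : ℝ → ℝ := fun l => ν (σ * (⌊l / σ⌋ : ℝ)) with hn
  have hround : ∀ l, σ * (⌊l / σ⌋ : ℝ) ≤ l ∧ l - σ < σ * (⌊l / σ⌋ : ℝ) := fun l => by
    have h1 := Int.floor_le (l / σ)
    have h2 := Int.lt_floor_add_one (l / σ)
    rw [le_div_iff₀ hσ] at h1
    rw [div_lt_iff₀ hσ] at h2
    constructor <;> linarith
  have hnM : ∀ l, 0 ≤ n l ∧ n l ≤ M := fun l => hν _
  have hnmeas : Measurable n :=
    (measurable_of_countable fun k : ℤ => ν (σ * (k : ℝ))).comp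
      (Int.measurable_floor.comp (measurable_id.div_const σ))
  have hni : ∀ x y : ℝ, IntervalIntegrable n volume x y := fun x y => by
    refine (intervalIntegrable_const (c := M)).mono_fun hnmeas.aestronglyMeasurable
      (ae_of_all _ fun l => ?_)
    simp only [Real.norm_of_nonneg (hnM l).1, Real.norm_of_nonneg ((hnM l).1.trans (hnM l).2)]
    exact (hnM l).2
  have hbd : ∀ x y : ℝ, x ≤ y → 0 ≤ ∫ l in x..y, n l ∧ ∫ l in x..y, n l ≤ M * (y - x) := by
    intro x y hxy
    refine ⟨intervalIntegral.integral_nonneg hxy fun l _ => (hnM l).1, ?_⟩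
    have := intervalIntegral.integral_mono hxy (hni x y) (intervalIntegrable_const (c := M))
      fun l => (hnM l).2
    rwa [intervalIntegral.integral_const, smul_eq_mul, mul_comm] at this
  refine ⟨fun x => σ⁻¹ * ∫ l in x..x + σ, n l, fun x => ⟨?_, ?_⟩, fun x hx => ?_, ?_, ?_⟩
  · exact mul_nonneg (inv_nonneg.2 hσ.le) (hbd x _ (by linarith)).1
  · have := (hbd x (x + σ) (by linarith)).2
    rw [inv_mul_le_iff₀ hσ]; linarith
  · have : ∫ l in x..x + σ, n l = ∫ l in x..x + σ, (0 : ℝ) := by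
      refine intervalIntegral.integral_congr fun l hl => ?_
      rw [Set.uIcc_of_le (by linarith)] at hl
      exact hνΛ _ (by linarith [(hround l).2, hl.1])
    simp only [this]; simp
  · have main : ∀ x y, x ≤ y →
        |σ⁻¹ * (∫ l in x..x + σ, n l) - σ⁻¹ * ∫ l in y..y + σ, n l| ≤ M / σ * (y - x) := by
      intro x y hxy
      rw [← mul_sub, intervalIntegral.integral_interval_sub_interval_comm (hni _ _) (hni _ _)
        (hni _ _), abs_mul, abs_of_pos (inv_pos.2 hσ), inv_mul_le_iff₀ hσ]
      have h1 := hbd x y hxy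
      have h2 := hbd (x + σ) (y + σ) (by linarith)
      have h3 : σ * (M / σ * (y - x)) = M * (y - x) := by field_simp
      rw [h3, abs_le]
      constructor <;> linarith
    intro x y
    rcases le_total x y with h | h
    · rw [abs_of_nonpos (sub_nonpos.2 h), neg_sub]; exact main x y h
    · rw [abs_of_nonneg (sub_nonneg.2 h), abs_sub_comm]; exact main y x h
  · intro x hx c d e h
    have := intervalIntegral.integral_mono_on (show x ≤ x + σ by linarith)
      ((intervalIntegrable_const (c := c)).add ((hni x (x + σ)).mul_const d))
      (intervalIntegrable_const (c := e)) fun l hl => by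
        have hl0 : 0 ≤ σ * (⌊l / σ⌋ : ℝ) :=
          mul_nonneg hσ.le (by exact_mod_cast Int.floor_nonneg.2 (div_nonneg (hx.trans hl.1) hσ.le))
        exact h _ hl0 (by linarith [(hround l).2, hl.1]) ((hround l).1.trans hl.2)
    rw [intervalIntegral.integral_add intervalIntegrable_const ((hni _ _).mul_const d),
      intervalIntegral.integral_mul_const, intervalIntegral.integral_const,
      intervalIntegral.integral_const, add_sub_cancel_left, smul_eq_mul, smul_eq_mul] at this
    have h2 := mul_le_mul_of_nonneg_left this (inv_nonneg.2 hσ.le)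
    rw [mul_add, ← mul_assoc, ← mul_assoc, ← mul_assoc, inv_mul_cancel₀ hσ.ne', one_mul,
      one_mul] at h2
    exact h2

/-! ### The potential along the learner's updates -/

/-- The primitive of a nonnegative bounded `K`-Lipschitz function that vanishes beyond `Λ` changes
along a step as predicted to first order, up to a quadratic error. -/
theorem exists_potential {f : ℝ → ℝ} {M K Λ : ℝ} (hf : ∀ x, 0 ≤ f x ∧ f x ≤ M)
    (hfΛ : ∀ x, Λ ≤ x → f x = 0) (hK : 0 ≤ K) (hlip : ∀ x y, |f x - f y| ≤ K * |x - y|)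
    (hΛ : 0 ≤ Λ) :
    ∃ Φ : ℝ → ℝ, (∀ x, 0 ≤ x → 0 ≤ Φ x ∧ Φ x ≤ M * Λ) ∧ (∀ x, Λ ≤ x → Φ x = Φ Λ) ∧
      ∀ x y, f x * (y - x) ≤ Φ y - Φ x + K * (y - x) ^ 2 := by
  have hcont : Continuous f := by
    have : LipschitzWith ⟨K, hK⟩ f := LipschitzWith.of_dist_le_mul fun x y => by
      rw [Real.dist_eq, Real.dist_eq]; exact hlip x y
    exact this.continuous
  have hi : ∀ x y, IntervalIntegrable f volume x y := fun x y => hcont.intervalIntegrable x y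
  have hconst : ∀ x, Λ ≤ x → ∫ l in (0 : ℝ)..x, f l = ∫ l in (0 : ℝ)..Λ, f l := by
    intro x hx
    rw [← intervalIntegral.integral_add_adjacent_intervals (hi 0 Λ) (hi Λ x)]
    have : ∫ l in Λ..x, f l = ∫ l in Λ..x, (0 : ℝ) := by
      refine intervalIntegral.integral_congr fun l hl => ?_
      rw [Set.uIcc_of_le hx] at hl
      exact hfΛ l hl.1
    rw [this]; simp
  have hle : ∀ x, 0 ≤ x → ∫ l in (0 : ℝ)..x, f l ≤ M * x := fun x hx => by
    have := intervalIntegral.integral_mono hx (hi 0 x) (intervalIntegrable_const (c := M))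
      fun l => (hf l).2
    rwa [intervalIntegral.integral_const, smul_eq_mul, mul_comm, sub_zero] at this
  have hM : 0 ≤ M := (hf 0).1.trans (hf 0).2
  refine ⟨fun x => ∫ l in (0 : ℝ)..x, f l, fun x hx => ⟨?_, ?_⟩, hconst, fun x y => ?_⟩
  · exact intervalIntegral.integral_nonneg hx fun l _ => (hf l).1
  · rcases le_total x Λ with h | h
    · exact (hle x hx).trans (mul_le_mul_of_nonneg_left h hM)
    · simp only [hconst x h]; exact hle Λ hΛ
  · simp only
    rw [intervalIntegral.integral_interval_sub_left (hi 0 y) (hi 0 x)]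
    have h1 : ‖∫ l in x..y, (f l - f x)‖ ≤ K * |y - x| * |y - x| := by
      refine intervalIntegral.norm_integral_le_of_norm_le_const fun l hl => ?_
      refine (hlip l x).trans (mul_le_mul_of_nonneg_left ?_ hK)
      have := Set.abs_sub_left_of_mem_uIcc (Set.uIoc_subset_uIcc hl)
      exact this
    rw [intervalIntegral.integral_sub (hi x y) intervalIntegrable_const,
      intervalIntegral.integral_const, smul_eq_mul, mul_assoc, ← sq, sq_abs] at h1
    have := (abs_le.1 h1).1
    linarith

/-- Along the learner's updates, the spending errors `ρL - l P`, weighted with a price `f l` that is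
a Lipschitz function of the multiplier, telescope up to a quadratic error. Multipliers beyond the
support of `f` may take long steps, but a step that enters the support from beyond `2 Λ` would have
to more than halve the multiplier, which the step size rules out. -/
theorem sum_price_mul_error_le {f : ℝ → ℝ} {M K Λ : ℝ} (hf : ∀ x, 0 ≤ f x ∧ f x ≤ M)
    (hfΛ : ∀ x, Λ ≤ x → f x = 0) (hK : 0 ≤ K) (hlip : ∀ x y, |f x - f y| ≤ K * |x - y|)
    (hΛ : 0 ≤ Λ) {η ρL : ℝ} (hη : 0 < η) (hη2 : η ≤ 1 / 2) (hρL : 0 ≤ ρL) {l P : ℕ → ℝ}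
    (hl0 : 0 ≤ l 0) (hP : ∀ t, 0 ≤ P t ∧ P t ≤ 1)
    (hl : ∀ t, l (t + 1) = l t + η * (ρL - l t * P t)) (T : ℕ) :
    ∑ t ∈ Finset.range T, f (l t) * (ρL - l t * P t) ≤
      M * Λ / η + K * (ρL + 2 * Λ) ^ 2 * η * T := by
  obtain ⟨Φ, hΦ, hΦΛ, hstep⟩ := exists_potential hf hfΛ hK hlip hΛ
  have hlower : ∀ t, 0 ≤ l t → l t * (1 - η) ≤ l (t + 1) := fun t ht => by
    rw [hl]
    have h1 := mul_le_mul_of_nonneg_left (hP t).2 (mul_nonneg hη.le ht)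
    have h2 : 0 ≤ η * ρL := by positivity
    linarith
  have hnn : ∀ t, 0 ≤ l t := fun t => by
    induction t with
    | zero => exact hl0
    | succ t ih => exact (mul_nonneg ih (by linarith)).trans (hlower t ih)
  have hone : ∀ t, η * (f (l t) * (ρL - l t * P t)) ≤
      Φ (l (t + 1)) - Φ (l t) + K * (ρL + 2 * Λ) ^ 2 * η ^ 2 := by
    intro t
    have hd : l (t + 1) - l t = η * (ρL - l t * P t) := by rw [hl]; ring
    rcases le_or_gt (2 * Λ) (l t) with h | h
    · have h1 : Λ ≤ l (t + 1) := by
        have := hlower t (hnn t)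
        nlinarith [hnn t]
      rw [hfΛ _ (by linarith), hΦΛ _ h1, hΦΛ (l t) (by linarith)]
      simp only [zero_mul, mul_zero, sub_self, zero_add]
      positivity
    · have h1 := hstep (l t) (l (t + 1))
      rw [hd] at h1
      have h2 : (ρL - l t * P t) ^ 2 ≤ (ρL + 2 * Λ) ^ 2 := by
        have h3 : l t * P t ≤ 2 * Λ :=
          (mul_le_of_le_one_right (hnn t) (hP t).2).trans h.le
        have h4 : 0 ≤ l t * P t := mul_nonneg (hnn t) (hP t).1
        exact sq_le_sq' (by linarith) (by linarith)
      have h3 : K * (η * (ρL - l t * P t)) ^ 2 ≤ K * (ρL + 2 * Λ) ^ 2 * η ^ 2 := by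
        rw [mul_pow, mul_assoc, mul_comm (η ^ 2)]
        exact mul_le_mul_of_nonneg_left (mul_le_mul_of_nonneg_right h2 (sq_nonneg η)) hK
      linarith
  have hsum : η * ∑ t ∈ Finset.range T, f (l t) * (ρL - l t * P t) ≤
      M * Λ + K * (ρL + 2 * Λ) ^ 2 * η ^ 2 * T := by
    rw [Finset.mul_sum]
    refine (Finset.sum_le_sum fun t _ => hone t).trans ?_
    rw [Finset.sum_add_distrib, Finset.sum_range_sub (fun t => Φ (l t)), Finset.sum_const,
      Finset.card_range, nsmul_eq_mul]
    linarith [(hΦ _ (hnn T)).2, (hΦ _ (hnn 0)).1]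
  rw [← le_div_iff₀' hη] at hsum
  refine hsum.trans (le_of_eq ?_)
  field_simp

/-! ### The repeated game -/

/-- Resampling one coordinate of an i.i.d. sequence does not change its law. -/
theorem measurePreserving_update_infinitePi {X : Type*} [MeasurableSpace X] (D : Measure X)
    [IsProbabilityMeasure D] (t : ℕ) :
    MeasurePreserving (fun p : (ℕ → X) × X => Function.update p.1 t p.2)
      ((Measure.infinitePi fun _ : ℕ => D).prod D) (Measure.infinitePi fun _ : ℕ => D) := by
  have hm : Measurable (fun p : (ℕ → X) × X => Function.update p.1 t p.2) := measurable_update'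
  refine ⟨hm, Measure.eq_infinitePi _ fun s A hA => ?_⟩
  rw [Measure.map_apply hm (MeasurableSet.pi s.countable_toSet fun i _ => hA i)]
  have hpre : (fun p : (ℕ → X) × X => Function.update p.1 t p.2) ⁻¹' (Set.pi s A) =
      (Set.pi (s.erase t : Finset ℕ) A) ×ˢ (if t ∈ s then A t else Set.univ) := by
    ext ⟨v, w⟩
    simp only [Set.mem_preimage, Set.mem_pi, Set.mem_prod, Finset.mem_coe, Finset.mem_erase]
    constructor
    · intro h
      refine ⟨fun i hi => ?_, ?_⟩
      · simpa [Function.update_of_ne hi.1] using h i hi.2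
      · split_ifs with ht
        · simpa using h t ht
        · trivial
    · rintro ⟨h1, h2⟩ i hi
      by_cases hit : i = t
      · subst hit; rw [if_pos hi] at h2; simpa using h2
      · simpa [Function.update_of_ne hit] using h1 i ⟨hit, hi⟩
  rw [hpre, Measure.prod_prod, Measure.infinitePi_pi _ fun i _ => hA i]
  split_ifs with ht
  · exact Finset.prod_erase_mul s (fun i => D (A i)) ht
  · rw [measure_univ, mul_one, Finset.erase_eq_of_notMem ht]

/-- An expectation can be bounded by conditioning on everything except the values of one round. -/
theorem integral_le_of_forall_resample {S : Type*} [MeasurableSpace S] (ν : Measure S)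
    [IsProbabilityMeasure ν] {X : Type*} [MeasurableSpace X] (D : Measure X)
    [IsProbabilityMeasure D] (t : ℕ) {F : S × (ℕ → X) → ℝ} (hF : Measurable F) {C c : ℝ}
    (hC : ∀ p, |F p| ≤ C) (h : ∀ s v, ∫ w, F (s, Function.update v t w) ∂D ≤ c) :
    ∫ p, F p ∂(ν.prod (Measure.infinitePi fun _ : ℕ => D)) ≤ c := by
  have hi : Integrable F (ν.prod (Measure.infinitePi fun _ : ℕ => D)) :=
    Integrable.of_bound hF.aestronglyMeasurable C (ae_of_all _ hC)
  have hle : ∀ s, ∫ v, F (s, v) ∂(Measure.infinitePi fun _ : ℕ => D) ≤ c := fun s => by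
    have hmp := measurePreserving_update_infinitePi D t
    have hFs : Measurable fun v => F (s, v) := hF.comp measurable_prodMk_left
    have hiu : Integrable (fun p : (ℕ → X) × X => F (s, Function.update p.1 t p.2))
        ((Measure.infinitePi fun _ : ℕ => D).prod D) :=
      Integrable.of_bound (hFs.comp hmp.measurable).aestronglyMeasurable C
        (ae_of_all _ fun y => hC _)
    rw [← hmp.map_eq, integral_map hmp.measurable.aemeasurable hFs.aestronglyMeasurable,
      integral_prod _ hiu]
    simpa using integral_mono hiu.integral_prod_left (integrable_const c) fun v => h s v
  rw [integral_prod _ hi]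
  simpa using integral_mono hi.integral_prod_left (integrable_const c) hle

namespace OptStrategy

variable {S : Type} [MeasurableSpace S] (B : OptStrategy S) (a : AuctionFormat) {ρL η lam1 : ℝ}

theorem measurable_bidAt (t : ℕ) :
    Measurable fun p : S × (ℕ → ValuePair) => B.bidAt p.1 p.2 t := by
  refine (B.measurable_bid t).comp (measurable_fst.prodMk (Measurable.prodMk ?_ ?_))
  · exact measurable_pi_lambda _ fun i => (measurable_pi_apply _).comp measurable_snd
  · exact measurable_snd.comp ((measurable_pi_apply t).comp measurable_snd)

theorem measurable_multiplier (t : ℕ) :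
    Measurable fun p : S × (ℕ → ValuePair) => B.multiplier a ρL η lam1 p.1 p.2 t := by
  induction t with
  | zero => exact measurable_const
  | succ t ih =>
    have hP : Measurable fun p : S × (ℕ → ValuePair) => payL a (B.bidAt p.1 p.2 t) (p.2 t) :=
      (measurable_payL a).comp
        (((measurable_pi_apply t).comp measurable_snd).prodMk (B.measurable_bidAt t))
    exact ih.add ((measurable_const.sub (ih.mul hP)).const_mul η)

theorem multiplier_nonneg (hρL : 0 ≤ ρL) (hη : 0 ≤ η) (hη1 : η ≤ 1) (hlam : 0 ≤ lam1) (s : S)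
    (v : ℕ → ValuePair) (t : ℕ) : 0 ≤ B.multiplier a ρL η lam1 s v t := by
  induction t with
  | zero => exact hlam
  | succ t ih =>
    have h1 := mul_le_mul hη1 (payL_le_one a (B.bidAt s v t) (v t)) (payL_nonneg _ _ _) zero_le_one
    have h2 := mul_le_mul_of_nonneg_left h1 ih
    have h3 := mul_nonneg hη hρL
    simp only [multiplier]
    linarith

theorem multiplier_le (hρL : 0 ≤ ρL) (hη : 0 ≤ η) (hη1 : η ≤ 1) (hlam : 0 ≤ lam1) (s : S)
    (v : ℕ → ValuePair) (t : ℕ) : B.multiplier a ρL η lam1 s v t ≤ lam1 + t * (η * ρL) := by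
  induction t with
  | zero => simp [multiplier]
  | succ t ih =>
    have h1 := mul_nonneg hη (mul_nonneg (B.multiplier_nonneg a hρL hη hη1 hlam s v t)
      (payL_nonneg a (B.bidAt s v t) (v t)))
    simp only [multiplier]
    push_cast
    linarith

/-- The multiplier of a round depends on the values of the previous rounds only. -/
theorem multiplier_congr {s : S} {v v' : ℕ → ValuePair} (t : ℕ) (h : ∀ i < t, v i = v' i) :
    B.multiplier a ρL η lam1 s v t = B.multiplier a ρL η lam1 s v' t := by
  induction t with
  | zero => rfl
  | succ t ih =>
    have hb : B.bidAt s v t = B.bidAt s v' t := by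
      unfold bidAt
      rw [h t (Nat.lt_succ_self t), show (fun i : Fin t => v i) = fun i : Fin t => v' i from
        funext fun i => h i (i.2.trans (Nat.lt_succ_self t))]
    simp only [multiplier, ih fun i hi => h i (hi.trans (Nat.lt_succ_self t)), hb,
      h t (Nat.lt_succ_self t)]

/-- The value of one round in the Lagrangian with prices `μ` and `f`. The optimizer's payment is
that of the capped bid, so that it is bounded. -/
noncomputable def lagrangian (ρL η lam1 μ : ℝ) (f : ℝ → ℝ) (t : ℕ) (p : S × (ℕ → ValuePair)) : ℝ :=
  valO (B.bidAt p.1 p.2 t) (p.2 t) -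
    μ * (B.multiplier a ρL η lam1 p.1 p.2 t * payO a (min (B.bidAt p.1 p.2 t) 2) (p.2 t)) +
    f (B.multiplier a ρL η lam1 p.1 p.2 t) *
      (B.multiplier a ρL η lam1 p.1 p.2 t * payL a (B.bidAt p.1 p.2 t) (p.2 t) - ρL)

theorem measurable_lagrangian {μ : ℝ} {f : ℝ → ℝ} (hf : Measurable f) (t : ℕ) :
    Measurable (B.lagrangian a ρL η lam1 μ f t) := by
  have hv : Measurable fun p : S × (ℕ → ValuePair) => p.2 t :=
    (measurable_pi_apply t).comp measurable_snd
  have hb := B.measurable_bidAt t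
  have hl := B.measurable_multiplier a (ρL := ρL) (η := η) (lam1 := lam1) t
  have hU := measurable_valO.comp (hv.prodMk hb)
  have hO := (measurable_payO a).comp (hv.prodMk (hb.min (measurable_const (a := (2 : ℝ≥0)))))
  have hL := (measurable_payL a).comp (hv.prodMk hb)
  exact (hU.sub ((hl.mul hO).const_mul μ)).add ((hf.comp hl).mul ((hl.mul hL).sub_const ρL))

theorem abs_lagrangian_le {μ M : ℝ} {f : ℝ → ℝ} (hρL : 0 ≤ ρL) (hη : 0 ≤ η) (hη1 : η ≤ 1)
    (hlam : 0 ≤ lam1) (hμ : 0 ≤ μ) (hf : ∀ x, 0 ≤ f x ∧ f x ≤ M) (t : ℕ)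
    (p : S × (ℕ → ValuePair)) :
    |B.lagrangian a ρL η lam1 μ f t p| ≤
      1 + μ * ((lam1 + t * (η * ρL)) * 2) + M * (lam1 + t * (η * ρL) + ρL) := by
  have hl0 := B.multiplier_nonneg a hρL hη hη1 hlam p.1 p.2 t
  have hl1 := B.multiplier_le a hρL hη hη1 hlam p.1 p.2 t
  unfold lagrangian
  generalize B.multiplier a ρL η lam1 p.1 p.2 t = l at *
  generalize lam1 + t * (η * ρL) = l' at *
  generalize B.bidAt p.1 p.2 t = b
  have hO2 : payO a (min b 2) (p.2 t) ≤ 2 :=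
    (payO_le_bid a _ _).trans (by exact_mod_cast min_le_right b 2)
  have h1 : |valO b (p.2 t)| ≤ 1 := by
    rw [abs_of_nonneg (valO_nonneg _ _)]; exact valO_le_one _ _
  have h2 : |μ * (l * payO a (min b 2) (p.2 t))| ≤ μ * (l' * 2) := by
    have hO := payO_nonneg a (min b 2) (p.2 t)
    rw [abs_of_nonneg (by positivity)]
    exact mul_le_mul_of_nonneg_left (mul_le_mul hl1 hO2 hO (hl0.trans hl1)) hμ
  have h3 : |l * payL a b (p.2 t) - ρL| ≤ l' + ρL := by
    have hL0 := mul_nonneg hl0 (payL_nonneg a b (p.2 t))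
    have hL1 := mul_le_of_le_one_right hl0 (payL_le_one a b (p.2 t))
    rw [abs_le]; constructor <;> linarith
  have h4 : |f l * (l * payL a b (p.2 t) - ρL)| ≤ M * (l' + ρL) := by
    rw [abs_mul, abs_of_nonneg (hf l).1]
    exact mul_le_mul (hf l).2 h3 (abs_nonneg _) ((hf l).1.trans (hf l).2)
  exact (abs_add_le _ _).trans (add_le_add ((abs_sub _ _).trans (add_le_add h1 h2)) h4)

/-- Conditionally on the past, the expected Lagrangian of a round is that of a one-round outcome. -/
theorem integral_lagrangian_le (ν : Measure S) [IsProbabilityMeasure ν] (D : Measure ValuePair)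
    [IsProbabilityMeasure D] {μ M A : ℝ} {f : ℝ → ℝ} (hρL : 0 ≤ ρL) (hη : 0 ≤ η) (hη1 : η ≤ 1)
    (hlam : 0 ≤ lam1) (hμ : 0 ≤ μ) (hf : ∀ x, 0 ≤ f x ∧ f x ≤ M) (hfm : Measurable f)
    (hdual : ∀ l, 0 ≤ l → ∀ p ∈ outcomes a D,
      p.1 - μ * (l * p.2.1) + f l * (l * p.2.2 - ρL) ≤ A) (t : ℕ) :
    ∫ p, B.lagrangian a ρL η lam1 μ f t p ∂(ν.prod (Measure.infinitePi fun _ : ℕ => D)) ≤ A := by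
  refine integral_le_of_forall_resample ν D t (B.measurable_lagrangian a hfm t)
    (B.abs_lagrangian_le a hρL hη hη1 hlam hμ hf t) fun s v => ?_
  set l := B.multiplier a ρL η lam1 s v t with hl
  set β : unitInterval → ℝ≥0 := fun x => min (B.bid t s (fun i : Fin t => v i) x) 2 with hβdef
  have hβ : Measurable β :=
    ((B.measurable_bid t).comp
      (measurable_const.prodMk (measurable_const.prodMk measurable_id))).min measurable_const
  have hβ2 : ∀ x, β x ≤ 2 := fun x => min_le_right _ _
  have hlw : ∀ w, B.multiplier a ρL η lam1 s (Function.update v t w) t = l := fun w =>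
    B.multiplier_congr a t fun i hi => Function.update_of_ne hi.ne _ _
  have hbw : ∀ w : ValuePair, min (B.bidAt s (Function.update v t w) t) 2 = β w.2 := fun w => by
    unfold bidAt
    rw [Function.update_self, show (fun i : Fin t => Function.update v t w i) = fun i : Fin t => v i
      from funext fun i => Function.update_of_ne i.2.ne _ _]
  have heq : ∀ w : ValuePair, B.lagrangian a ρL η lam1 μ f t (s, Function.update v t w) =
      valO (β w.2) w - μ * (l * payO a (β w.2) w) + f l * (l * payL a (β w.2) w - ρL) := fun w => by
    simp only [lagrangian]
    rw [hlw, ← valO_min_two, ← payL_min_two, hbw, Function.update_self]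
  have hU := integrable_valO_bid D hβ
  have hO : Integrable (fun w : ValuePair => μ * (l * payO a (β w.2) w)) D :=
    ((integrable_payO_bid a D hβ hβ2).const_mul l).const_mul μ
  have hL := (integrable_payL_bid a D hβ).const_mul l
  have hUO : Integrable (fun w : ValuePair => valO (β w.2) w - μ * (l * payO a (β w.2) w)) D :=
    hU.sub hO
  have hLρ : Integrable (fun w : ValuePair => f l * (l * payL a (β w.2) w - ρL)) D :=
    (hL.sub (integrable_const ρL)).const_mul (f l)
  simp only [heq]
  rw [integral_add hUO hLρ, integral_sub hU hO, integral_const_mul, integral_const_mul,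
    integral_const_mul, integral_sub hL (integrable_const ρL), integral_const_mul,
    integral_const, probReal_univ, one_smul]
  exact hdual l (B.multiplier_nonneg a hρL hη hη1 hlam s v t) _
    (detOutcome_mem_outcomes a D hβ hβ2)

theorem measurable_totalValue (T : ℕ) :
    Measurable fun p : S × (ℕ → ValuePair) => B.totalValue T p.1 p.2 :=
  Finset.measurable_sum _ fun t _ => measurable_valO.comp
    (((measurable_pi_apply t).comp measurable_snd).prodMk (B.measurable_bidAt t))

theorem totalValue_nonneg (T : ℕ) (s : S) (v : ℕ → ValuePair) : 0 ≤ B.totalValue T s v :=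
  Finset.sum_nonneg fun _ _ => valO_nonneg _ _

theorem totalValue_le (T : ℕ) (s : S) (v : ℕ → ValuePair) : B.totalValue T s v ≤ T := by
  have := Finset.sum_le_sum fun t (_ : t ∈ Finset.range T) =>
    valO_le_one (B.bidAt s v t) (v t)
  simpa [totalValue] using this

theorem integrable_totalValue (m : Measure (S × (ℕ → ValuePair))) [IsProbabilityMeasure m]
    (T : ℕ) : Integrable (fun p => B.totalValue T p.1 p.2) m :=
  Integrable.of_bound (B.measurable_totalValue T).aestronglyMeasurable T (ae_of_all _ fun p => by
    rw [Real.norm_of_nonneg (B.totalValue_nonneg _ _ _)]; exact B.totalValue_le _ _ _)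

/-- Weak duality for the repeated game: prices `μ` and `f` that certify the value `A` for one round
certify it for `T` rounds, up to the telescoping error of the learner's spending. -/
theorem integral_totalValue_le (ν : Measure S) [IsProbabilityMeasure ν] (D : Measure ValuePair)
    [IsProbabilityMeasure D] {μ M K Λ A ρO : ℝ} {f : ℝ → ℝ} (hρL : 0 ≤ ρL) (hη : 0 < η)
    (hη2 : η ≤ 1 / 2) (hlam : 0 ≤ lam1) (hμ : 0 ≤ μ) (hf : ∀ x, 0 ≤ f x ∧ f x ≤ M)
    (hfΛ : ∀ x, Λ ≤ x → f x = 0) (hK : 0 ≤ K) (hlip : ∀ x y, |f x - f y| ≤ K * |x - y|)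
    (hΛ : 0 ≤ Λ)
    (hdual : ∀ l, 0 ≤ l → ∀ p ∈ outcomes a D,
      p.1 - μ * (l * p.2.1) + f l * (l * p.2.2 - ρL) ≤ A) (T : ℕ)
    (hbudget : ∀ᵐ p ∂(ν.prod (Measure.infinitePi (fun _ : ℕ => D))),
      B.totalPayment a ρL η lam1 T p.1 p.2 ≤ ρO * T) :
    ∫ p, B.totalValue T p.1 p.2 ∂(ν.prod (Measure.infinitePi (fun _ : ℕ => D))) ≤
      T * A + (μ * (ρO * T) + (M * Λ / η + K * (ρL + 2 * Λ) ^ 2 * η * T)) := by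
  have hη1 : η ≤ 1 := by linarith
  have hfm : Measurable f := by
    have : LipschitzWith ⟨K, hK⟩ f := LipschitzWith.of_dist_le_mul fun x y => by
      rw [Real.dist_eq, Real.dist_eq]; exact hlip x y
    exact this.continuous.measurable
  set m := ν.prod (Measure.infinitePi (fun _ : ℕ => D)) with hm
  set R := μ * (ρO * T) + (M * Λ / η + K * (ρL + 2 * Λ) ^ 2 * η * T) with hR
  have hGi : ∀ t, Integrable (B.lagrangian a ρL η lam1 μ f t) m := fun t =>
    Integrable.of_bound (B.measurable_lagrangian a hfm t).aestronglyMeasurable _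
      (ae_of_all _ fun p => B.abs_lagrangian_le a hρL hη.le hη1 hlam hμ hf t p)
  have hpt : ∀ᵐ p ∂m, B.totalValue T p.1 p.2 ≤
      (∑ t ∈ Finset.range T, B.lagrangian a ρL η lam1 μ f t p) + R := by
    filter_upwards [hbudget] with p hp
    have h1 := sum_price_mul_error_le hf hfΛ hK hlip hΛ hη hη2 hρL
      (l := fun t => B.multiplier a ρL η lam1 p.1 p.2 t)
      (P := fun t => payL a (B.bidAt p.1 p.2 t) (p.2 t)) hlam
      (fun _ => ⟨payL_nonneg _ _ _, payL_le_one _ _ _⟩) (fun _ => rfl) T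
    have h2 : ∑ t ∈ Finset.range T, B.multiplier a ρL η lam1 p.1 p.2 t *
        payO a (min (B.bidAt p.1 p.2 t) 2) (p.2 t) ≤ ρO * T :=
      (Finset.sum_le_sum fun t _ => mul_le_mul_of_nonneg_left (payO_min_two_le a _ _)
        (B.multiplier_nonneg a hρL hη.le hη1 hlam p.1 p.2 t)).trans hp
    have h3 := mul_le_mul_of_nonneg_left h2 hμ
    have h4 : B.totalValue T p.1 p.2 = (∑ t ∈ Finset.range T, B.lagrangian a ρL η lam1 μ f t p) +
        (μ * (∑ t ∈ Finset.range T, B.multiplier a ρL η lam1 p.1 p.2 t *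
          payO a (min (B.bidAt p.1 p.2 t) 2) (p.2 t)) +
        ∑ t ∈ Finset.range T, f (B.multiplier a ρL η lam1 p.1 p.2 t) *
          (ρL - B.multiplier a ρL η lam1 p.1 p.2 t * payL a (B.bidAt p.1 p.2 t) (p.2 t))) := by
      rw [Finset.mul_sum, ← Finset.sum_add_distrib, ← Finset.sum_add_distrib]
      refine Finset.sum_congr rfl fun t _ => ?_
      simp only [lagrangian]
      ring
    rw [h4]
    linarith
  have hsum : Integrable (fun p => ∑ t ∈ Finset.range T, B.lagrangian a ρL η lam1 μ f t p) m :=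
    integrable_finsetSum _ fun t _ => hGi t
  refine (integral_mono_ae (B.integrable_totalValue m T)
    (hsum.add (integrable_const R)) hpt).trans ?_
  rw [integral_add' hsum (integrable_const R), integral_finsetSum _ fun t _ => hGi t,
    integral_const, probReal_univ, one_smul]
  have := Finset.sum_le_sum fun t (_ : t ∈ Finset.range T) =>
    B.integral_lagrangian_le a ν D hρL hη.le hη1 hlam hμ hf hfm hdual t
  rw [Finset.sum_const, Finset.card_range, nsmul_eq_mul] at this
  linarith

end OptStrategy

/-! ### The bound on the excess -/

theorem bseOpt_nonneg (a : AuctionFormat) (D : Measure ValuePair) (ρO ρL : ℝ) :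
    0 ≤ bseOpt a D ρO ρL := by
  refine Real.sSup_nonneg ?_
  rintro _ ⟨k, w, lam, κ, hw, -, -, -, -, -, -, rfl⟩
  exact Finset.sum_nonneg fun i _ =>
    mul_nonneg (hw i) (integral_nonneg fun y => valO_nonneg _ _)

section Excess

variable (a : AuctionFormat) (D : Measure ValuePair) [IsProbabilityMeasure D] {ρO ρL : ℝ}

/-- Prices of both budgets that certify the value `OPT` in one round. -/
theorem exists_prices {ε : ℝ} (hε : 0 < ε) (hρO : 0 < ρO) (hρL : 0 < ρL)
    (hD : D {v : ValuePair | 0 < (v.1 : ℝ) ∧ (v.1 : ℝ) < ε * (v.2 : ℝ)} = 0)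
    (hvL : 0 < ∫ v : ValuePair, (v.1 : ℝ) ∂D) :
    ∃ (μ M Λ : ℝ) (ν : ℝ → ℝ), 0 ≤ μ ∧ 0 ≤ M ∧ 0 ≤ Λ ∧ (∀ l, 0 ≤ ν l ∧ ν l ≤ M) ∧
      (∀ l, Λ ≤ l → ν l = 0) ∧ ∀ l, 0 ≤ l → ∀ p ∈ outcomes a D,
        p.1 - μ * (l * p.2.1) + ν l * (l * p.2.2 - ρL) ≤ bseOpt a D ρO ρL - μ * ρO := by
  obtain ⟨μ, hμ, h⟩ := exists_budget_price a D hρO hρL hvL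
  rcases hμ.eq_or_lt with rfl | hμ
  · refine ⟨0, 0, 0, fun _ => 0, le_rfl, le_rfl, le_rfl, fun _ => ⟨le_rfl, le_rfl⟩,
      fun _ _ => rfl, fun l _ p hp => ?_⟩
    have := outcome_le_of_budget_price_zero a D hρL hvL
      (fun l hl p hp hpL => by simpa using h l hl p hp hpL) hp
    simpa using this
  · obtain ⟨M, Λ, ν, hM, hΛ, hν, hνΛ, hdual⟩ := exists_learner_prices a D hε hμ hρL hD hvL h
    exact ⟨μ, M, Λ, ν, hμ.le, hM, hΛ, hν, hνΛ, hdual⟩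

/-- The excess over `T * OPT` for an arbitrary smoothing width `σ` of the learner's prices. -/
theorem exists_excess_bound {ε : ℝ} (hε : 0 < ε) (hρO : 0 < ρO) (hρL : 0 < ρL)
    (hD : D {v : ValuePair | 0 < (v.1 : ℝ) ∧ (v.1 : ℝ) < ε * (v.2 : ℝ)} = 0)
    (hvL : 0 < ∫ v : ValuePair, (v.1 : ℝ) ∂D) :
    ∃ C : ℝ, 0 < C ∧ ∀ (η σ lam1 : ℝ) (T : ℕ), 0 < η → η < 1 → 0 < σ → 0 ≤ lam1 →
      ∀ x ∈ achievableValues a D ρO ρL η lam1 T,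
        x ≤ T * bseOpt a D ρO ρL + C * (σ * T + η * T / σ + 1 / η) := by
  obtain ⟨μ, M, Λ, ν, hμ, hM, hΛ, hν, hνΛ, hdual⟩ := exists_prices a D hε hρO hρL hD hvL
  -- Smoothing the prices costs `c₁ σ` per round; `c₂` and `c₃` come from the potential.
  set c₁ := 2 * μ + M with hc₁
  set c₂ := M * (ρL + 2 * (Λ + 1)) ^ 2 with hc₂
  set c₃ := M * (Λ + 1) with hc₃
  have h₁ : 0 ≤ c₁ := by positivity
  have h₂ : 0 ≤ c₂ := by positivity
  have h₃ : 0 ≤ c₃ := by positivity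
  refine ⟨2 + c₁ + c₂ + c₃, by positivity, ?_⟩
  rintro η σ lam1 T hη hη1 hσ hlam _ ⟨S, _, m, _, B, hbudget, rfl⟩
  have hT : (0 : ℝ) ≤ T := T.cast_nonneg
  have hx : 0 ≤ σ * T := by positivity
  have hy : 0 ≤ η * T / σ := by positivity
  have hz : 0 ≤ 1 / η := by positivity
  -- If `σ ≥ 1` or `η > 1/2`, the error term exceeds `T`.
  by_cases htriv : (T : ℝ) ≤ 2 * (σ * T + η * T / σ)
  · have hV : ∫ p, B.totalValue T p.1 p.2 ∂(m.prod (Measure.infinitePi (fun _ : ℕ => D))) ≤ T := by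
      simpa using integral_mono
        (B.integrable_totalValue (m.prod (Measure.infinitePi (fun _ : ℕ => D))) T)
        (integrable_const (T : ℝ)) fun p => B.totalValue_le T p.1 p.2
    have hopt := mul_nonneg hT (bseOpt_nonneg a D ρO ρL)
    have hrest : 0 ≤ (c₁ + c₂ + c₃) * (σ * T + η * T / σ + 1 / η) := by positivity
    linarith
  have hσ1 : σ ≤ 1 := by
    by_contra! hc
    have := mul_le_mul_of_nonneg_right hc.le hT
    exact htriv (by linarith)
  have hη2 : η ≤ 1 / 2 := by
    by_contra! hc
    have h1 : (T : ℝ) / 2 ≤ η * T := by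
      have := mul_le_mul_of_nonneg_right hc.le hT
      linarith
    have h2 : η * T ≤ η * T / σ := le_div_self (by positivity) hσ hσ1
    exact htriv (by linarith)
  obtain ⟨f, hf, hfΛ, hlip, havg⟩ := exists_lipschitz_average hσ hν hνΛ
  have hfdual : ∀ l, 0 ≤ l → ∀ p ∈ outcomes a D,
      p.1 - μ * (l * p.2.1) + f l * (l * p.2.2 - ρL) ≤
        bseOpt a D ρO ρL - μ * ρO + c₁ * σ := by
    intro l hl p hp
    refine havg l hl _ _ _ fun l' hl' hlo hhi => ?_
    obtain ⟨-, ⟨hO0, hO2⟩, ⟨hL0, hL1⟩⟩ := outcomes_bounds a D hp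
    have h1 := hdual l' hl' p hp
    have h2 : μ * ((l' - l) * p.2.1) ≤ μ * (σ * 2) :=
      mul_le_mul_of_nonneg_left (mul_le_mul (by linarith) hO2 hO0 hσ.le) hμ
    have h3 : ν l' * ((l - l') * p.2.2) ≤ M * (σ * 1) :=
      (mul_le_mul_of_nonneg_left (mul_le_mul (by linarith) hL1 hL0 hσ.le) (hν l').1).trans
        (mul_le_mul_of_nonneg_right (hν l').2 (by linarith))
    rw [hc₁]
    linarith
  have hmain := B.integral_totalValue_le a m D hρL.le hη hη2 hlam hμ hf
    (fun x hx => hfΛ x (by linarith)) (div_nonneg hM hσ.le) hlip (show 0 ≤ Λ + 1 by linarith)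
    hfdual T hbudget
  have e₂ : M / σ * (ρL + 2 * (Λ + 1)) ^ 2 * η * T = c₂ * (η * T / σ) := by rw [hc₂]; ring
  have e₃ : M * (Λ + 1) / η = c₃ * (1 / η) := by rw [hc₃]; ring
  rw [e₂, e₃] at hmain
  have i₁ := mul_nonneg h₁ hy
  have i₂ := mul_nonneg h₁ hz
  have i₃ := mul_nonneg h₂ hx
  have i₄ := mul_nonneg h₂ hz
  have i₅ := mul_nonneg h₃ hx
  have i₆ := mul_nonneg h₃ hy
  linarith

end Excess

theorem mainTheorem1 (a : AuctionFormat) (D : Measure ValuePair) [IsProbabilityMeasure D]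
    (ρO ρL : ℝ) (hρO : 0 < ρO) (hρL : 0 < ρL)
    (hvL : 0 < ∫ v : ValuePair, (v.1 : ℝ) ∂D)
    (hD : ∃ ε : ℝ, 0 < ε ∧ D {v : ValuePair | 0 < (v.1 : ℝ) ∧ (v.1 : ℝ) < ε * (v.2 : ℝ)} = 0) :
    (∃ C : ℝ, 0 < C ∧ ∀ (η σ lam1 : ℝ) (T : ℕ), 0 < η → η < 1 → 0 < σ → 0 ≤ lam1 →
      ∀ x ∈ achievableValues a D ρO ρL η lam1 T,
        x ≤ T * bseOpt a D ρO ρL + C * (σ * T + η * T / σ + 1 / η)) ∧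
    (∀ c₁ c₂ : ℝ, 0 < c₁ → ∃ C : ℝ, 0 < C ∧ ∀ (η lam1 : ℝ) (T : ℕ), 1 ≤ T →
      0 < η → η < 1 → 0 ≤ lam1 →
      c₁ * (T : ℝ) ^ (-(2 / 3) : ℝ) ≤ η → η ≤ c₂ * (T : ℝ) ^ (-(2 / 3) : ℝ) →
      ∀ x ∈ achievableValues a D ρO ρL η lam1 T,
        x ≤ T * bseOpt a D ρO ρL + C * (T : ℝ) ^ (2 / 3 : ℝ)) ∧
    (∀ η : ℕ → ℝ, (∀ T, 0 < η T ∧ η T < 1) → Tendsto η atTop (𝓝 0) →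
      Tendsto (fun T : ℕ => (T : ℝ) * η T) atTop atTop →
      ∃ r : ℕ → ℝ, r =o[atTop] (fun T : ℕ => (T : ℝ)) ∧
        ∀ (lam1 : ℝ) (T : ℕ), 0 ≤ lam1 →
          ∀ x ∈ achievableValues a D ρO ρL (η T) lam1 T,
            x ≤ T * bseOpt a D ρO ρL + r T) := by
  obtain ⟨ε, hε, hD⟩ := hD
  obtain ⟨C, hC, hbound⟩ := exists_excess_bound a D hε hρO hρL hD hvL
  refine ⟨⟨C, hC, hbound⟩, fun c₁ c₂ hc₁ => ?_, fun η hη hη0 hηT => ?_⟩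
  · refine ⟨C * (1 + |c₂| + 1 / c₁), by positivity, ?_⟩
    intro η lam1 T hT hη hη1 hlam hlo hhi x hx
    have hT0 : (0 : ℝ) < T := by exact_mod_cast hT
    -- With `η` of order `T ^ (-2/3)`, the choice `σ = T ^ (-1/3)` balances the three error terms.
    have h := hbound η ((T : ℝ) ^ (-(1 / 3) : ℝ)) lam1 T hη hη1 (by positivity) hlam x hx
    have e₁ : (T : ℝ) ^ (-(1 / 3) : ℝ) * T = (T : ℝ) ^ (2 / 3 : ℝ) := by
      rw [← Real.rpow_add_one hT0.ne']; norm_num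
    have e₂ : η * T / (T : ℝ) ^ (-(1 / 3) : ℝ) ≤ |c₂| * (T : ℝ) ^ (2 / 3 : ℝ) := by
      have hle : η ≤ |c₂| * (T : ℝ) ^ (-(2 / 3) : ℝ) :=
        hhi.trans (mul_le_mul_of_nonneg_right (le_abs_self _) (by positivity))
      have : (T : ℝ) ^ (-(2 / 3) : ℝ) * T / (T : ℝ) ^ (-(1 / 3) : ℝ) = (T : ℝ) ^ (2 / 3 : ℝ) := by
        rw [← Real.rpow_add_one hT0.ne', ← Real.rpow_sub hT0]; norm_num
      rw [← this, mul_div_assoc, mul_div_assoc, ← mul_assoc]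
      exact mul_le_mul_of_nonneg_right hle (by positivity)
    have e₃ : 1 / η ≤ 1 / c₁ * (T : ℝ) ^ (2 / 3 : ℝ) := by
      refine (one_div_le_one_div_of_le (by positivity) hlo).trans (le_of_eq ?_)
      rw [Real.rpow_neg hT0.le]; field_simp
    have := mul_le_mul_of_nonneg_left (add_le_add (add_le_add e₁.le e₂) e₃) hC.le
    linarith
  · refine ⟨fun T => C * (√(η T) * T + η T * T / √(η T) + 1 / η T), ?_, fun lam1 T hlam x hx =>
      hbound (η T) (√(η T)) lam1 T (hη T).1 (hη T).2 (Real.sqrt_pos.2 (hη T).1) hlam x hx⟩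
    refine IsLittleO.const_mul_left ?_ C
    rw [isLittleO_iff_tendsto' (by
      filter_upwards [eventually_ge_atTop 1] with T hT h0
      exact absurd h0 (by positivity))]
    have hsqrt : Tendsto (fun T => √(η T)) atTop (𝓝 0) := by
      simpa [Function.comp_def] using (Real.continuous_sqrt.tendsto 0).comp hη0
    have hlim := (hsqrt.add hsqrt).add hηT.inv_tendsto_atTop
    rw [add_zero, add_zero] at hlim
    refine hlim.congr' ?_
    filter_upwards [eventually_ge_atTop 1] with T hT
    have hT0 : (0 : ℝ) < T := by exact_mod_cast hT
    have hs : 0 < √(η T) := Real.sqrt_pos.2 (hη T).1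
    have hηpos := (hη T).1
    have : η T * T / √(η T) = √(η T) * T := by
      rw [div_eq_iff hs.ne', mul_right_comm, Real.mul_self_sqrt hηpos.le]
    simp only [Pi.inv_apply]
    rw [this]
    field_simp
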